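/- **Model.** The network is a connected $n$-vertex graph $G$ whose vertices have unique identifiers in $\{1,\dots,N\}$ and carry inputs (coded by natural numbers). Computation proceeds in synchronous rounds. In each round a vertex is asleep or awake; an awake vertex may send an arbitrarily large message, possibly a different one, to each neighbour, receives the messages sent to it in that round by its awake neighbours, and then computes its new state and either terminates with an output or decides how many rounds it sleeps before its next awake round (the first awake round is determined by the initial state). A sleeping or terminated vertex does not send, receive or compute, and messages sent to it are lost. Each vertex initially knows $N$, its identifier and its input. The *awake complexity* of an execution is the maximum over all vertices of the number of rounds in which the vertex is awake. A deterministic algorithm *solves* a problem if in every instance all vertices terminate and their outputs form a solution. **Problems.** A problem specifies which output assignments are solutions on which input graph (with identifiers and inputs). It is *decidable* if a sequential deterministic (computable) algorithm finds a solution for every input graph. A *distributed layered tree* (DLT) is a rooted spanning tree with labels $L(v)\in\mathbb N$ such that $L(v)>L(p(v))$ for every non-root vertex $v$ with parent $p(v)$; every vertex outputs $L(v)$ and, unless it is the root, also $p(v)$ and $L(p(v))$. *Leader election* requires exactly one vertex to be elected. A problem $P$ is *DLT-hard* if there are a deterministic sleeping algorithm $R$ and a function $r(n)=o(\log n)$ such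 that, when the vertices of any $n$-vertex input graph are given any solution of $P$, $R$ computes a DLT, or there are such $R$ and $r$ for leader election, always with awake complexity at most $r(n)$. **Theorem.** The class of decidable DLT-hard problems has deterministic awake complexity $\Theta(\log n)$ in the sleeping model. That is, there are absolute constants $c,C>0$ such that for every decidable DLT-hard problem $P$: 1. there is a deterministic algorithm with computable local computations that solves $P$ on every input graph, for every $N$, with awake complexity at most $C\log n$ whenever $n\ge 2$ (regardless of $N$); 2. there are $n_0$ and $\rho:\mathbb N\to\mathbb N$ such that for all $n\ge n_0$ and all $N\ge\rho(n)$, every deterministic algorithm that solves $P$ on all $n$-vertex input graphs with identifiers in $\{1,\dots,N\}$ has awake complexity at least $c\log n$ on some such graph. This holds without a bound on the number of clock rounds, even if local computations may be arbitrary functions and each vertex also knows $n$ and the identifiers of its neighbours initially. (In the definition of DLT-hardness, too, $R$ may use such functions and such knowledge.) -/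

import Mathlib

open Filter Asymptotics

namespace Sleeping

/-- A connected input graph. Vertices have unique positive identifiers, and a vertex *is* its
identifier; each vertex carries an input, coded by a natural number. -/
structure InputGraph where
  ids : Finset ℕ
  ids_pos : ∀ i ∈ ids, 1 ≤ i
  graph : SimpleGraph {i // i ∈ ids}
  connected : graph.Connected
  input : {i // i ∈ ids} → ℕ

namespace InputGraph

/-- The vertices of the graph. -/
abbrev V (G : InputGraph) : Type := {i // i ∈ G.ids}

/-- The number `n` of vertices. -/
def size (G : InputGraph) : ℕ := G.ids.card

/-- All identifiers belong to `{1, …, N}`. -/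
def BoundedBy (G : InputGraph) (N : ℕ) : Prop := ∀ i ∈ G.ids, i ≤ N

/-- The same graph with other inputs. -/
def withInput (G : InputGraph) (x : G.V → ℕ) : InputGraph where
  ids := G.ids
  ids_pos := G.ids_pos
  graph := G.graph
  connected := G.connected
  input := x

open Classical in
/-- The vertices that satisfy `p`, listed by increasing identifier. -/
noncomputable def list (G : InputGraph) (p : G.V → Prop) : List G.V :=
  (Finset.univ.filter p).sort (· ≤ ·)

/-- The increasing list of the identifiers of the neighbours of `v`. -/
noncomputable def nbrIds (G : InputGraph) (v : G.V) : List ℕ :=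
  (G.list (fun u => G.graph.Adj v u)).map Subtype.val

/-- The input graph as finite data: for every vertex, by increasing identifier, its identifier,
its input and the identifiers of its neighbours. -/
noncomputable def code (G : InputGraph) : List (ℕ × ℕ × List ℕ) :=
  (G.list (fun _ => True)).map (fun v => (v.1, G.input v, G.nbrIds v))

end InputGraph

/-- A distributed graph problem: which output assignments are solutions on which input graph. -/
structure Problem where
  IsSolution : (G : InputGraph) → (G.V → ℕ) → Prop

/-- A problem is decidable if one sequential algorithm computes a solution for every input graph:
`f (G.code, i)` is the output of the vertex with identifier `i`. -/
def Problem.IsDecidable (P : Problem) : Prop :=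
  ∃ f : List (ℕ × ℕ × List ℕ) × ℕ → ℕ, Computable f ∧
    ∀ G : InputGraph, P.IsSolution G (fun v => f (G.code, v.1))

/-- A deterministic algorithm in the sleeping model. Memory contents ("states"), messages and
outputs are coded by natural numbers, without any bound on their size.
* `start n N i x l` is the initial state of a vertex with identifier `i`, input `x` and increasing
  list `l` of neighbour identifiers, in a graph with `n` vertices and identifiers in `{1, …, N}`;
* `output s` is `some o` if a vertex in state `s` has terminated with output `o`;
* `delay s` is the number of rounds for which a vertex that has just entered the (nonterminated)
  state `s` sleeps before its next awake round;
* `send s j` is the message which a vertex that is awake in state `s` sends to its neighbour with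
  identifier `j`;
* `step s m` is the state after an awake round that was begun in state `s` and in which the
  messages `m` were received, each with the identifier of its sender. -/
structure Algorithm where
  start : ℕ → ℕ → ℕ → ℕ → List ℕ → ℕ
  output : ℕ → Option ℕ
  delay : ℕ → ℕ
  send : ℕ → ℕ → ℕ
  step : ℕ → List (ℕ × ℕ) → ℕ

/-- The situation of one vertex between two rounds: its state, and the number of rounds that it
still sleeps. -/
structure VertexStatus where
  state : ℕ
  timer : ℕ

namespace Algorithm

/-- All local computations are computable. -/
def IsComputable (A : Algorithm) : Prop :=
  Computable (fun p : ℕ × ℕ × ℕ × ℕ × List ℕ => A.start p.1 p.2.1 p.2.2.1 p.2.2.2.1 p.2.2.2.2) ∧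
  Computable A.output ∧ Computable A.delay ∧ Computable₂ A.send ∧ Computable₂ A.step

/-- The algorithm uses no initial knowledge beyond the upper bound on the identifiers (hence on the
number of vertices) and the vertex's own identifier and input. -/
def UsesOnlyBound (A : Algorithm) : Prop :=
  ∀ n n' N i x l l', A.start n N i x l = A.start n' N i x l'

/-- The vertex is awake in the round that begins in this status. -/
def Awake (A : Algorithm) (c : VertexStatus) : Prop := A.output c.state = none ∧ c.timer = 0

/-- The status of a vertex that has just entered state `s`. -/
def enter (A : Algorithm) (s : ℕ) : VertexStatus := ⟨s, A.delay s⟩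

/-- The messages received by `v` in a round in which it is awake: those of its awake neighbours,
listed by increasing identifier of the sender. -/
noncomputable def received (A : Algorithm) (G : InputGraph) (c : G.V → VertexStatus) (v : G.V) :
    List (ℕ × ℕ) :=
  (G.list (fun u => G.graph.Adj v u ∧ A.Awake (c u))).map
    (fun u => (u.1, A.send (c u).state v.1))

open Classical in
/-- The execution on `G` with identifier bound `N`: `A.run G N t` is the status of all vertices
after `t` clock rounds. A vertex that is asleep or has terminated neither computes nor
communicates. -/
noncomputable def run (A : Algorithm) (G : InputGraph) (N : ℕ) : ℕ → G.V → VertexStatus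
  | 0 => fun v => A.enter (A.start G.size N v.1 (G.input v) (G.nbrIds v))
  | t + 1 => fun v =>
      if A.Awake (A.run G N t v) then
        A.enter (A.step (A.run G N t v).state (A.received G (A.run G N t) v))
      else ⟨(A.run G N t v).state, (A.run G N t v).timer - 1⟩

/-- After finitely many clock rounds all vertices have terminated, and `o` is their output. -/
def Outputs (A : Algorithm) (G : InputGraph) (N : ℕ) (o : G.V → ℕ) : Prop :=
  ∃ T, ∀ v, A.output (A.run G N T v).state = some (o v)

/-- The number of rounds in which `v` is awake (a finite number if `v` terminates). -/
noncomputable def awakeRounds (A : Algorithm) (G : InputGraph) (N : ℕ) (v : G.V) : ℕ :=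
  {t : ℕ | A.Awake (A.run G N t v)}.ncard

/-- The worst-case awake complexity of the execution: the maximum over all vertices. -/
noncomputable def awakeComplexity (A : Algorithm) (G : InputGraph) (N : ℕ) : ℕ :=
  Finset.univ.sup (A.awakeRounds G N)

/-- `A` solves `P` on all input graphs with `n` vertices and identifiers in `{1, …, N}`. -/
def SolvesAt (A : Algorithm) (P : Problem) (n N : ℕ) : Prop :=
  ∀ G : InputGraph, G.size = n → G.BoundedBy N → ∃ o, A.Outputs G N o ∧ P.IsSolution G o

/-- `A` solves `P` on all input graphs, whatever the upper bound on the identifiers. -/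
def Solves (A : Algorithm) (P : Problem) : Prop := ∀ n N, A.SolvesAt P n N

end Algorithm

/-- `parent` describes a rooted spanning tree of `G` with root `root`, oriented towards the
root. -/
def IsRootedSpanningTree (G : InputGraph) (root : G.V) (parent : G.V → G.V) : Prop :=
  parent root = root ∧ (∀ v, v ≠ root → G.graph.Adj v (parent v)) ∧
    ∀ v, ∃ k : ℕ, parent^[k] v = root

/-- Distributed layered tree: a labelled rooted spanning tree in which the label of every nonroot
vertex is greater than that of its parent. A nonroot vertex outputs its label, the identifier of
its parent and the label of its parent; the root outputs its label. -/
def DLT : Problem where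
  IsSolution G o := ∃ (root : G.V) (parent : G.V → G.V) (L : G.V → ℕ),
    IsRootedSpanningTree G root parent ∧
    (∀ v, v ≠ root → L (parent v) < L v) ∧
    o root = Encodable.encode (L root, (none : Option (ℕ × ℕ))) ∧
    ∀ v, v ≠ root → o v = Encodable.encode (L v, some ((parent v).1, L (parent v)))

/-- Leader election: exactly one vertex elects itself, by the output `1`. -/
def LeaderElection : Problem where
  IsSolution _ o := ∃! v, o v = 1

/-- A solution of `P` yields a solution of `Q` within `o(log n)` additional awake rounds: there is
an algorithm which, when every vertex is given any solution of `P` in addition to its input, solves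
`Q` with awake complexity `o(log n)`. -/
def Yields (P Q : Problem) : Prop :=
  ∃ (R : Algorithm) (r : ℕ → ℝ), r =o[atTop] (fun n : ℕ => Real.log n) ∧
    ∀ (G : InputGraph) (N : ℕ) (s : G.V → ℕ), G.BoundedBy N → P.IsSolution G s →
      (∃ o : G.V → ℕ, R.Outputs (G.withInput fun v => Nat.pair (G.input v) (s v)) N o ∧
        Q.IsSolution G o) ∧
      (R.awakeComplexity (G.withInput fun v => Nat.pair (G.input v) (s v)) N : ℝ) ≤ r G.size

/-- DLT-hard: a solution yields a distributed layered tree or a leader within `o(log n)` additional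
awake rounds. -/
def DLTHard (P : Problem) : Prop := Yields P DLT ∨ Yields P LeaderElection

end Sleeping

/-!
**Upper bound.** A decidable problem is solved by collecting the whole input graph at every vertex
(`Sleeping.Gather.exists_algorithm`). The vertices are partitioned into connected clusters, each
named after one of its vertices, and every vertex knows all about its own cluster. In each phase
every cluster determines its target, the adjacent cluster with the largest name, and clusters are
merged along the chains of targets. If `p d` is the target of `d`, then `d ≤ p (p d)`, so `d + p d`
increases along a chain until it ends in two clusters that are each other's target
(`IsTargetMap.mutual_iterate`). Every new cluster contains at least two old ones
(`Several.card_merged`), which leaves at most `log₂ n` phases.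

A phase costs a vertex a bounded number of awake rounds (`card_candidates_le`). It is divided into
slots, and the clusters `d` and `p d` meet in slot `3 + (d + p d)`. As the sums increase along
chains, information flows in the course of the first half of the phase from all clusters to the pair
at the end of their chain; in the second half the order of the slots is reversed and it flows back
(`covers_of_phaseStart`). A cluster takes part in at most seven slots. Within a slot, the layers of
the breadth-first tree of the cluster are awake one after the other, first towards the root and then
away from it, so that a vertex is awake in at most five rounds (`TakesPart.clusterKnows`).

**Lower bound.** Consider cycles with distinct labels, and follow the given algorithm by the one
that elects a leader from a solution; by `exists_leader_of_dltHard` a distributed layered tree also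
gives a leader. Any `3 ^ (a + 1)` labels can be arranged in a segment with a vertex whose status
does not depend on the rest of the cycle until a round in which it is awake and before which it has
been awake `a` times (`CycleProcess.exists_determined`). Indeed, given three such segments for `a`, put
the one whose vertex is awake first into the middle. Until that round the vertices of the outer two
are determined by their segments, hence so are all vertices between them
(`CycleProcess.Agree.between`), and the middle vertex learns nothing from outside in that round
either. If no vertex is awake more than `k` times, then segments of `3 ^ (k + 2)` labels suffice for
a vertex that is independent of the rest of the cycle for ever.

If `3 ^ (k + 2)` is small compared with `n`, distribute three such vertices over a cycle. The leader
lies in one of the three arcs between them, of length at most `n / 2`, and whether a vertex of this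
arc becomes the leader does not depend on the rest of the cycle
(`CycleProcess.exists_forced_leader`). The same holds for a second arc with other labels, and a
cycle that contains both has two leaders (`CycleProcess.not_existsUnique_leader`). Hence
`k > log n / 4` for large `n`, while the election of the leader costs only `o(log n)`.
-/


namespace Sleeping

/-! ### Single rounds of an execution -/

namespace Algorithm

variable {A : Algorithm} {G : InputGraph} {N t : ℕ} {v : G.V}

theorem run_succ_of_awake (h : A.Awake (A.run G N t v)) :
    A.run G N (t + 1) v =
      A.enter (A.step (A.run G N t v).state (A.received G (A.run G N t) v)) := by
  rw [Algorithm.run]; exact if_pos h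

theorem run_succ_of_not_awake (h : ¬ A.Awake (A.run G N t v)) :
    A.run G N (t + 1) v = ⟨(A.run G N t v).state, (A.run G N t v).timer - 1⟩ := by
  rw [Algorithm.run]; exact if_neg h

end Algorithm

end Sleeping

namespace Sleeping.Gather

/-! ### An algorithm that collects the input graph -/

/-- What is known about one vertex, in the format of `InputGraph.code`: its identifier, its input
and the identifiers of its neighbours. -/
abbrev Entry := ℕ × ℕ × List ℕ

/-- An entry together with the name of the cluster to which its vertex belongs. -/
abbrev Fact := ℕ × Entry

/-- The memory of a vertex: the identifier bound `N`, its identifier, its input, the clock round at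
which this memory was entered, the name of its cluster, and the facts that it knows. -/
abbrev State := ℕ × ℕ × ℕ × ℕ × ℕ × List Fact

/-- Every neighbour of every known member of cluster `d` is known. If some member is known, then
connectedness of the cluster implies that all its members and all their neighbours are known. -/
def Surrounded (K : List Fact) (d : ℕ) : Prop :=
  ∀ f ∈ K, f.1 = d → ∀ w ∈ f.2.2.2, ∃ g ∈ K, g.2.1 = w

instance (K : List Fact) (d : ℕ) : Decidable (Surrounded K d) := by
  unfold Surrounded; infer_instance

/-- The names of the known clusters adjacent to cluster `d`. -/
def adjacentNames (K : List Fact) (d : ℕ) : List ℕ :=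
  (K.filter (fun g => g.1 ≠ d ∧ ∃ f ∈ K, f.1 = d ∧ g.2.1 ∈ f.2.2.2)).map Prod.fst

/-- The largest name of a cluster adjacent to cluster `d`, as computed from the facts `K`; it is
`0` unless `K` contains enough facts to be sure about it. -/
def target (K : List Fact) (d : ℕ) : ℕ :=
  if Surrounded K d then (adjacentNames K d).foldr max 0 else 0

/-- The name of the new cluster of `d`. The chain of targets ends in a pair of clusters which are
each other's target; the larger of their names is the new name. -/
def newName (K : List Fact) (N d : ℕ) : ℕ :=
  max ((target K)^[2 * N + 1] d) (target K ((target K)^[2 * N + 1] d))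

/-- The identifiers of the vertices at distance at most `k` from vertex `d` within cluster `d`. -/
def ball (K : List Fact) (d k : ℕ) : List ℕ :=
  (fun B => (K.filter (fun g => g.1 = d ∧
    (g.2.1 ∈ B ∨ ∃ f ∈ K, (f.1 = d ∧ f.2.1 ∈ B) ∧ g.2.1 ∈ f.2.2.2))).map (fun g => g.2.1))^[k] [d]

/-- The distance of vertex `v` from vertex `d` within cluster `d`: the number of balls
around `d`, of radius less than `N`, that do not contain `v`. -/
def layer (K : List Fact) (d v N : ℕ) : ℕ :=
  ((List.range N).filter (fun k => v ∉ ball K d k)).length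

/-- No edge leaves cluster `d`. -/
def Closed (K : List Fact) (d : ℕ) : Prop :=
  ∀ f ∈ K, f.1 = d → ∀ w ∈ f.2.2.2, ∃ g ∈ K, g.1 = d ∧ g.2.1 = w

instance (K : List Fact) (d : ℕ) : Decidable (Closed K d) := by
  unfold Closed; infer_instance

/-- The number of clock rounds of a slot: enough to send a message from the vertices of a cluster to
its root and back, since the distance from the root is less than `N`. -/
def slotLength (N : ℕ) : ℕ := 2 * N + 4

/-- The index of the middle slot of a phase. It exceeds all slots of the first half, which are
indexed by sums of two names. -/
def middle (N : ℕ) : ℕ := 2 * N + 4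

/-- The number of clock rounds of a phase. -/
def phaseLength (N : ℕ) : ℕ := 2 * middle N * slotLength N

/-- The slots of a phase in which a cluster `d` with target `p` and `p'` the target of `p` takes
part. The cluster meets the clusters whose target it is in the slots at distance `d + p` from the
beginning and from the end of the phase, and its own target in those at distance `p + p'`. -/
def SlotActive (N d p p' s : ℕ) : Prop :=
  s = 1 ∨ s = 2 ∨ s = middle N ∨ s = 3 + (d + p) ∨ s = 3 + (p + p') ∨
    s + 3 + (d + p) = 2 * middle N ∨ s + 3 + (p + p') = 2 * middle N

instance (N d p p' s : ℕ) : Decidable (SlotActive N d p p' s) := by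
  unfold SlotActive; infer_instance

/-- The rounds of a slot in which a vertex of layer `l` of a cluster taking part is awake: the
first round, for the exchange between clusters, and the rounds in which it meets the adjacent
layers, once on the way to the root and once on the way back. -/
def RoundActive (N l r : ℕ) : Prop :=
  r = 0 ∨ r + l = N + 2 ∨ r + l + 1 = N + 2 ∨ r = N + 2 + l ∨ r = N + 2 + l + 1

instance (N l r : ℕ) : Decidable (RoundActive N l r) := by
  unfold RoundActive; infer_instance

/-- A vertex with memory `s` wants to be awake in clock round `t`: in the first round of a phase, in
which the clusters of the previous phase are merged, and in its rounds of the slots from `1` on in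
which its cluster takes part. -/
def Wakes (s : State) (t : ℕ) : Prop :=
  t % phaseLength s.1 = 0 ∨
    (t % phaseLength s.1 / slotLength s.1 ≠ 0 ∧
      SlotActive s.1 s.2.2.2.2.1 (target s.2.2.2.2.2 s.2.2.2.2.1)
        (target s.2.2.2.2.2 (target s.2.2.2.2.2 s.2.2.2.2.1))
        (t % phaseLength s.1 / slotLength s.1) ∧
      RoundActive s.1 (layer s.2.2.2.2.2 s.2.2.2.2.1 s.2.1 s.1)
        (t % phaseLength s.1 % slotLength s.1))

instance (s : State) (t : ℕ) : Decidable (Wakes s t) := by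
  unfold Wakes; infer_instance

/-- The time until the next round in which a vertex with memory `s` wants to be awake. It is shorter
than a phase. -/
def wait (s : State) : ℕ :=
  (List.range (phaseLength s.1)).findIdx (fun d => Wakes s (s.2.2.2.1 + d))

/-- The facts that survive the end of a phase: those about the members of the new
cluster, which are given its name. -/
def newFacts (K : List Fact) (N d : ℕ) : List Fact :=
  (K.filter (fun f => newName K N f.1 = newName K N d)).map (fun f => (newName K N d, f.2))

/-- The memory coded by a natural number, with a default value for numbers that code none. -/
def memory (s : ℕ) : State :=
  (@Encodable.decode State Primcodable.toEncodable s).getD (0, 0, 0, 0, 0, [])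

/-- The code of a memory. -/
def codeMemory (s : State) : ℕ := @Encodable.encode State Primcodable.toEncodable s

theorem memory_codeMemory (s : State) : memory (codeMemory s) = s := by
  rw [memory, codeMemory, Encodable.encodek]; rfl

/-- The memory after an awake round with received messages `m`. This round took place at the time
at which the memory `s` was entered plus `wait s`. -/
def next (s : State) (m : List (ℕ × ℕ)) : State :=
  -- In round `0` all vertices are awake, so the senders are all neighbours.
  if s.2.2.2.1 + wait s = 0 then
    (s.1, s.2.1, s.2.2.1, 1, s.2.1, [(s.2.1, s.2.1, s.2.2.1, m.map Prod.fst)])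
  else if (s.2.2.2.1 + wait s) % phaseLength s.1 = 0 then
    (s.1, s.2.1, s.2.2.1, s.2.2.2.1 + wait s + 1, newName s.2.2.2.2.2 s.1 s.2.2.2.2.1,
      newFacts s.2.2.2.2.2 s.1 s.2.2.2.2.1)
  else
    (s.1, s.2.1, s.2.2.1, s.2.2.2.1 + wait s + 1, s.2.2.2.2.1,
      s.2.2.2.2.2 ++ m.flatMap (fun p => (memory p.2).2.2.2.2.2))

/-- The entries of the known vertices by increasing identifier. -/
def entries (K : List Fact) (N : ℕ) : List Entry :=
  (List.range (N + 1)).filterMap (fun i => ((K.filter (fun f => f.2.1 = i)).map Prod.snd).head?)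

/-- The output of a vertex with memory `s`, which exists when its cluster is the whole graph. Time
`0` is excluded because no facts are known then, so that `Closed` holds vacuously. -/
def result (f : List Entry × ℕ → ℕ) (s : State) : Option ℕ :=
  if s.2.2.2.1 ≠ 0 ∧ Closed s.2.2.2.2.2 s.2.2.2.2.1 then
    some (f (entries s.2.2.2.2.2 s.1, s.2.1))
  else none

/-- The algorithm that collects the whole input graph at every vertex and then applies `f`. A
message consists of the whole memory of the sender. -/
def algorithm (f : List Entry × ℕ → ℕ) : Algorithm where
  start _ N i x _ := codeMemory ((N, i, x, 0, 0, []) : State)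
  output s := result f (memory s)
  delay s := wait (memory s)
  send s _ := s
  step s m := codeMemory (next (memory s) m)

/-! ### Computability of the gathering algorithm -/

section Primrec

open Primrec

variable {α β : Type*} [Primcodable α] [Primcodable β]

theorem primrec_filter {f : α → List β} {p : α → β → Prop} [∀ a, DecidablePred (p a)]
    (hf : Primrec f) (hp : PrimrecRel p) : Primrec fun a => (f a).filter (fun b => p a b) := by
  have h : PrimrecRel (fun b a => p a b) := PrimrecRel.comp₂ hp Primrec₂.right Primrec₂.left
  exact (PrimrecRel.listFilter h).comp hf Primrec.id

theorem primrecPred_exists {f : α → List β} {p : α → β → Prop} (hf : Primrec f)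
    (hp : PrimrecRel p) : PrimrecPred fun a => ∃ b ∈ f a, p a b := by
  have h : PrimrecRel (fun b a => p a b) := PrimrecRel.comp₂ hp Primrec₂.right Primrec₂.left
  exact (PrimrecRel.exists_mem_list h).comp hf Primrec.id

theorem primrecPred_forall {f : α → List β} {p : α → β → Prop} (hf : Primrec f)
    (hp : PrimrecRel p) : PrimrecPred fun a => ∀ b ∈ f a, p a b := by
  have h : PrimrecRel (fun b a => p a b) := PrimrecRel.comp₂ hp Primrec₂.right Primrec₂.left
  exact (PrimrecRel.forall_mem_list h).comp hf Primrec.id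

theorem primrecPred_mem {f : α → List ℕ} {g : α → ℕ} (hf : Primrec f) (hg : Primrec g) :
    PrimrecPred fun a => g a ∈ f a :=
  (primrecPred_exists (p := fun a b => b = g a) hf
    (Primrec.eq.comp snd (hg.comp fst))).of_eq (by simp)

theorem primrecPred_imp {p q : α → Prop} (hp : PrimrecPred p) (hq : PrimrecPred q) :
    PrimrecPred fun a => p a → q a :=
  (hp.not.or hq).of_eq fun _ => imp_iff_not_or.symm

theorem primrecRel_surrounded : PrimrecRel Surrounded :=
  primrecPred_forall (f := fun a : List Fact × ℕ => a.1)
    (p := fun a f => f.1 = a.2 → ∀ w ∈ f.2.2.2, ∃ g ∈ a.1, g.2.1 = w) fst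
    (primrecPred_imp (Primrec.eq.comp (fst.comp snd) (snd.comp fst))
      (primrecPred_forall (f := fun a : (List Fact × ℕ) × Fact => a.2.2.2.2)
        (p := fun a w => ∃ g ∈ a.1.1, g.2.1 = w) (snd.comp (snd.comp (snd.comp snd)))
        (primrecPred_exists (f := fun a : ((List Fact × ℕ) × Fact) × ℕ => a.1.1.1)
          (p := fun a g => g.2.1 = a.2) (fst.comp (fst.comp fst))
          (Primrec.eq.comp (fst.comp (snd.comp snd)) (snd.comp fst)))))

theorem primrecRel_closed : PrimrecRel Closed :=
  primrecPred_forall (f := fun a : List Fact × ℕ => a.1)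
    (p := fun a f => f.1 = a.2 → ∀ w ∈ f.2.2.2, ∃ g ∈ a.1, g.1 = a.2 ∧ g.2.1 = w) fst
    (primrecPred_imp (Primrec.eq.comp (fst.comp snd) (snd.comp fst))
      (primrecPred_forall (f := fun a : (List Fact × ℕ) × Fact => a.2.2.2.2)
        (p := fun a w => ∃ g ∈ a.1.1, g.1 = a.1.2 ∧ g.2.1 = w)
        (snd.comp (snd.comp (snd.comp snd)))
        (primrecPred_exists (f := fun a : ((List Fact × ℕ) × Fact) × ℕ => a.1.1.1)
          (p := fun a g => g.1 = a.1.1.2 ∧ g.2.1 = a.2) (fst.comp (fst.comp fst))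
          ((Primrec.eq.comp (fst.comp snd) (snd.comp (fst.comp (fst.comp fst)))).and
            (Primrec.eq.comp (fst.comp (snd.comp snd)) (snd.comp fst))))))

theorem primrec_adjacentNames : Primrec₂ adjacentNames :=
  list_map (primrec_filter (f := fun a : List Fact × ℕ => a.1)
    (p := fun a g => g.1 ≠ a.2 ∧ ∃ f ∈ a.1, f.1 = a.2 ∧ g.2.1 ∈ f.2.2.2) fst
    ((Primrec.eq.comp (fst.comp snd) (snd.comp fst)).not.and
      (primrecPred_exists (f := fun a : (List Fact × ℕ) × Fact => a.1.1)
        (p := fun a f => f.1 = a.1.2 ∧ a.2.2.1 ∈ f.2.2.2) (fst.comp fst)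
        ((Primrec.eq.comp (fst.comp snd) (snd.comp (fst.comp fst))).and
          (primrecPred_mem (snd.comp (snd.comp (snd.comp snd)))
            (fst.comp (snd.comp (snd.comp fst)))))))) (fst.comp snd)

theorem primrec_target : Primrec₂ target :=
  Primrec.ite primrecRel_surrounded
    (list_foldr (h := fun _ p => max p.1 p.2) primrec_adjacentNames (const 0)
      (nat_max.comp (fst.comp snd) (snd.comp snd)).to₂) (const 0)

theorem primrec_newName : Primrec fun a : List Fact × ℕ × ℕ => newName a.1 a.2.1 a.2.2 := by
  have h : Primrec fun a : List Fact × ℕ × ℕ => (target a.1)^[2 * a.2.1 + 1] a.2.2 :=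
    nat_iterate (succ.comp (nat_mul.comp (const 2) (fst.comp snd))) (snd.comp snd)
      (primrec_target.comp (fst.comp fst) snd)
  exact nat_max.comp h (primrec_target.comp fst h)

theorem primrec_ball : Primrec fun a : List Fact × ℕ × ℕ => ball a.1 a.2.1 a.2.2 :=
  nat_iterate (h := fun (a : List Fact × ℕ × ℕ) (B : List ℕ) =>
      (a.1.filter (fun g : Fact => g.1 = a.2.1 ∧ (g.2.1 ∈ B ∨
        ∃ f ∈ a.1, (f.1 = a.2.1 ∧ f.2.1 ∈ B) ∧ g.2.1 ∈ f.2.2.2))).map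
        (fun g : Fact => g.2.1))
    (snd.comp snd) (list_cons.comp (fst.comp snd) (const []))
    (list_map (g := fun (_ : (List Fact × ℕ × ℕ) × List ℕ) (g : Fact) => g.2.1)
      (primrec_filter (f := fun a : (List Fact × ℕ × ℕ) × List ℕ => a.1.1)
      (p := fun a g => g.1 = a.1.2.1 ∧ (g.2.1 ∈ a.2 ∨
        ∃ f ∈ a.1.1, (f.1 = a.1.2.1 ∧ f.2.1 ∈ a.2) ∧ g.2.1 ∈ f.2.2.2)) (fst.comp fst)
      ((Primrec.eq.comp (fst.comp snd) (fst.comp (snd.comp (fst.comp fst)))).and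
        ((primrecPred_mem (snd.comp fst) (fst.comp (snd.comp snd))).or
          (primrecPred_exists (f := fun a : ((List Fact × ℕ × ℕ) × List ℕ) × Fact => a.1.1.1)
            (p := fun a f => (f.1 = a.1.1.2.1 ∧ f.2.1 ∈ a.1.2) ∧ a.2.2.1 ∈ f.2.2.2)
            (fst.comp (fst.comp fst))
            (((Primrec.eq.comp (fst.comp snd)
              (fst.comp (snd.comp (fst.comp (fst.comp fst))))).and
              (primrecPred_mem (snd.comp (fst.comp fst)) (fst.comp (snd.comp snd)))).and
              (primrecPred_mem (snd.comp (snd.comp (snd.comp snd)))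
                (fst.comp (snd.comp (snd.comp fst)))))))))
      (fst.comp (snd.comp snd)).to₂).to₂

theorem primrec_layer :
    Primrec fun a : List Fact × ℕ × ℕ × ℕ => layer a.1 a.2.1 a.2.2.1 a.2.2.2 :=
  list_length.comp (primrec_filter (f := fun a : List Fact × ℕ × ℕ × ℕ => List.range a.2.2.2)
    (p := fun a k => a.2.2.1 ∉ ball a.1 a.2.1 k) (list_range.comp (snd.comp (snd.comp snd)))
    (primrecPred_mem (primrec_ball.comp ((fst.comp fst).pair
      ((fst.comp (snd.comp fst)).pair snd))) (fst.comp (snd.comp (snd.comp fst)))).not)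

theorem primrec_slotLength : Primrec slotLength :=
  nat_add.comp (nat_mul.comp (const 2) Primrec.id) (const 4)

theorem primrec_middle : Primrec middle :=
  nat_add.comp (nat_mul.comp (const 2) Primrec.id) (const 4)

theorem primrec_phaseLength : Primrec phaseLength :=
  nat_mul.comp (nat_mul.comp (const 2) primrec_middle) primrec_slotLength

attribute [local irreducible] target newName ball layer slotLength middle phaseLength

theorem primrecPred_slotActive {N d p p' s : α → ℕ} (hN : Primrec N) (hd : Primrec d)
    (hp : Primrec p) (hp' : Primrec p') (hs : Primrec s) :
    PrimrecPred fun a => SlotActive (N a) (d a) (p a) (p' a) (s a) := by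
  have hM := primrec_middle.comp hN
  have h2M := nat_mul.comp (const 2) hM
  have h1 := nat_add.comp hd hp
  have h2 := nat_add.comp hp hp'
  have hs3 := nat_add.comp hs (const 3)
  exact (Primrec.eq.comp hs (const 1)).or <| (Primrec.eq.comp hs (const 2)).or <|
    (Primrec.eq.comp hs hM).or <| (Primrec.eq.comp hs (nat_add.comp (const 3) h1)).or <|
    (Primrec.eq.comp hs (nat_add.comp (const 3) h2)).or <|
    (Primrec.eq.comp (nat_add.comp hs3 h1) h2M).or (Primrec.eq.comp (nat_add.comp hs3 h2) h2M)

theorem primrecPred_roundActive {N l r : α → ℕ} (hN : Primrec N) (hl : Primrec l)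
    (hr : Primrec r) : PrimrecPred fun a => RoundActive (N a) (l a) (r a) := by
  have hB := nat_add.comp hN (const 2)
  have h1 := nat_add.comp hr hl
  have h2 := nat_add.comp hB hl
  exact (Primrec.eq.comp hr (const 0)).or <| (Primrec.eq.comp h1 hB).or <|
    (Primrec.eq.comp (succ.comp h1) hB).or <| (Primrec.eq.comp hr h2).or
    (Primrec.eq.comp hr (succ.comp h2))

theorem primrecRel_wakes : PrimrecRel Wakes := by
  have hN : Primrec fun a : State × ℕ => a.1.1 := fst.comp fst
  have hv : Primrec fun a : State × ℕ => a.1.2.1 := fst.comp (snd.comp fst)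
  have hd : Primrec fun a : State × ℕ => a.1.2.2.2.2.1 :=
    fst.comp (snd.comp (snd.comp (snd.comp (snd.comp fst))))
  have hK : Primrec fun a : State × ℕ => a.1.2.2.2.2.2 :=
    snd.comp (snd.comp (snd.comp (snd.comp (snd.comp fst))))
  have hq := nat_mod.comp (snd : Primrec fun a : State × ℕ => a.2) (primrec_phaseLength.comp hN)
  have hW := primrec_slotLength.comp hN
  have hs := nat_div.comp hq hW
  have hp := primrec_target.comp hK hd
  have h1 := primrecPred_slotActive hN hd hp (primrec_target.comp hK hp) hs
  have h2 := primrecPred_roundActive hN (primrec_layer.comp (hK.pair (hd.pair (hv.pair hN))))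
        (nat_mod.comp hq hW)
  have h3 := (Primrec.eq.comp hq (const 0)).or ((Primrec.eq.comp hs (const 0)).not.and (h1.and h2))
  exact h3.of_eq fun a => by unfold Wakes; exact Iff.rfl

attribute [local irreducible] Wakes

theorem primrec_wait : Primrec wait :=
  list_findIdx (list_range.comp (primrec_phaseLength.comp fst))
    (primrecRel_wakes.comp fst (nat_add.comp
      (fst.comp (snd.comp (snd.comp (snd.comp fst)))) snd)).decide

theorem primrec_newFacts : Primrec fun a : List Fact × ℕ × ℕ => newFacts a.1 a.2.1 a.2.2 :=
  list_map (primrec_filter (f := fun a : List Fact × ℕ × ℕ => a.1)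
    (p := fun a f => newName a.1 a.2.1 f.1 = newName a.1 a.2.1 a.2.2) fst
    (Primrec.eq.comp
      (primrec_newName.comp ((fst.comp fst).pair ((fst.comp (snd.comp fst)).pair (fst.comp snd))))
      (primrec_newName.comp fst)))
    (Primrec.pair (primrec_newName.comp fst) (snd.comp snd))

theorem primrec_memory : Primrec memory :=
  option_getD.comp Primrec.decode (const _)

theorem primrec_codeMemory : Primrec codeMemory := Primrec.encode

attribute [irreducible] memory codeMemory

attribute [local irreducible] wait newFacts

theorem primrec_next : Primrec₂ next := by
  have hN : Primrec fun a : State × List (ℕ × ℕ) => a.1.1 := fst.comp fst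
  have hv : Primrec fun a : State × List (ℕ × ℕ) => a.1.2.1 := fst.comp (snd.comp fst)
  have hx : Primrec fun a : State × List (ℕ × ℕ) => a.1.2.2.1 :=
    fst.comp (snd.comp (snd.comp fst))
  have ht : Primrec fun a : State × List (ℕ × ℕ) => a.1.2.2.2.1 :=
    fst.comp (snd.comp (snd.comp (snd.comp fst)))
  have hd : Primrec fun a : State × List (ℕ × ℕ) => a.1.2.2.2.2.1 :=
    fst.comp (snd.comp (snd.comp (snd.comp (snd.comp fst))))
  have hK : Primrec fun a : State × List (ℕ × ℕ) => a.1.2.2.2.2.2 :=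
    snd.comp (snd.comp (snd.comp (snd.comp (snd.comp fst))))
  have hw := nat_add.comp ht (primrec_wait.comp fst)
  have hKNd := hK.pair (hN.pair hd)
  have hw1 : Primrec fun a : State × List (ℕ × ℕ) => a.1.2.2.2.1 + wait a.1 + 1 := succ.comp hw
  have hm : Primrec fun a : State × List (ℕ × ℕ) => a.2.map Prod.fst :=
    list_map (g := fun (_ : State × List (ℕ × ℕ)) (p : ℕ × ℕ) => p.1) snd (fst.comp snd)
  have he : Primrec fun a : State × List (ℕ × ℕ) =>
      [((a.1.2.1, a.1.2.1, a.1.2.2.1, a.2.map Prod.fst) : Fact)] :=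
    list_cons.comp (hv.pair (hv.pair (hx.pair hm))) (const [])
  have hg : Primrec fun a : State × List (ℕ × ℕ) =>
      a.2.flatMap (fun p => (memory p.2).2.2.2.2.2) := by
    have h : Primrec fun p : ℕ => (memory p).2.2.2.2.2 :=
      snd.comp (snd.comp (snd.comp (snd.comp (snd.comp primrec_memory))))
    have h' : Primrec₂ fun (_ : State × List (ℕ × ℕ)) (p : ℕ × ℕ) => (memory p.2).2.2.2.2.2 :=
      h.comp (snd.comp snd)
    exact list_flatMap snd h'
  have h := Primrec.ite (Primrec.eq.comp hw (const 0))
    (hN.pair (hv.pair (hx.pair ((const 1).pair (hv.pair he)))))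
    (Primrec.ite (Primrec.eq.comp (nat_mod.comp hw (primrec_phaseLength.comp hN)) (const 0))
      (hN.pair (hv.pair (hx.pair (hw1.pair ((primrec_newName.comp hKNd).pair
        (primrec_newFacts.comp hKNd))))))
      (hN.pair (hv.pair (hx.pair (hw1.pair (hd.pair (list_append.comp hK hg)))))))
  exact h.of_eq fun a => by unfold next; rfl

theorem primrec_entries : Primrec₂ entries :=
  listFilterMap (list_range.comp (succ.comp snd))
    (list_head?.comp (list_map (primrec_filter (f := fun a : (List Fact × ℕ) × ℕ => a.1.1)
      (p := fun a f => f.2.1 = a.2) (fst.comp fst)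
      (Primrec.eq.comp (fst.comp (snd.comp snd)) (snd.comp fst))) (snd.comp snd)))

attribute [local irreducible] next entries

theorem computable_result {f : List Entry × ℕ → ℕ} (hf : Computable f) :
    Computable (result f) := by
  have hN : Primrec fun a : State => a.1 := fst
  have ht : Primrec fun a : State => a.2.2.2.1 := fst.comp (snd.comp (snd.comp snd))
  have hd : Primrec fun a : State => a.2.2.2.2.1 :=
    fst.comp (snd.comp (snd.comp (snd.comp snd)))
  have hK : Primrec fun a : State => a.2.2.2.2.2 :=
    snd.comp (snd.comp (snd.comp (snd.comp snd)))
  have hc : PrimrecPred fun a : State => a.2.2.2.1 ≠ 0 ∧ Closed a.2.2.2.2.2 a.2.2.2.2.1 :=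
    (Primrec.eq.comp ht (const 0)).not.and (primrecRel_closed.comp hK hd)
  refine (Computable.cond hc.decide.to_comp
    (Computable.option_some.comp (hf.comp ((primrec_entries.comp hK hN).pair
      (fst.comp snd : Primrec fun a : State => a.2.1)).to_comp))
    (Computable.const none)).of_eq fun a => ?_
  unfold result
  split_ifs with h <;> simp [h]

attribute [local irreducible] result

theorem algorithm_isComputable {f : List Entry × ℕ → ℕ} (hf : Computable f) :
    (algorithm f).IsComputable := by
  have ho := primrec_memory
  have hs : Primrec₂ fun (s : ℕ) (m : List (ℕ × ℕ)) => codeMemory (next (memory s) m) :=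
    primrec_codeMemory.comp (primrec_next.comp (ho.comp Primrec.fst) Primrec.snd)
  have hr : Computable fun s : ℕ => result f (memory s) := (computable_result hf).comp ho.to_comp
  have hw : Primrec fun s : ℕ => wait (memory s) := primrec_wait.comp ho
  refine ⟨?_, hr, hw.to_comp, Computable.fst, hs.to_comp⟩
  have h : Primrec fun p : ℕ × ℕ × ℕ × ℕ × List ℕ =>
      ((p.2.1, p.2.2.1, p.2.2.2.1, 0, 0, []) : State) :=
    (Primrec.fst.comp Primrec.snd).pair
      ((Primrec.fst.comp (Primrec.snd.comp Primrec.snd)).pair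
      ((Primrec.fst.comp (Primrec.snd.comp (Primrec.snd.comp Primrec.snd))).pair
        (Primrec.const (0, 0, []))))
  exact (primrec_codeMemory.comp h).to_comp

end Primrec

theorem algorithm_usesOnlyBound (f : List Entry × ℕ → ℕ) : (algorithm f).UsesOnlyBound :=
  fun _ _ _ _ _ _ _ => rfl

end Sleeping.Gather


namespace Sleeping.Gather

/-! ### Chains of targets -/

section Chain

/-- The larger element of the pair in which the chain `d, p d, p (p d), …` ends. -/
def limitName (p : ℕ → ℕ) (N d : ℕ) : ℕ := max (p^[2 * N + 1] d) (p (p^[2 * N + 1] d))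

/-- `p` maps a set `S` of names at most `N` to itself such that `d + p d` does not decrease along
chains. -/
structure IsTargetMap (p : ℕ → ℕ) (S : Set ℕ) (N : ℕ) : Prop where
  map : ∀ d ∈ S, p d ∈ S
  le : ∀ d ∈ S, d ≤ N
  le_twice : ∀ d ∈ S, d ≤ p (p d)

variable {p : ℕ → ℕ} {S : Set ℕ} {N : ℕ}

theorem IsTargetMap.iterate (h : IsTargetMap p S N) {d : ℕ} (hd : d ∈ S) (i : ℕ) :
    p^[i] d ∈ S := by
  induction i with
  | zero => exact hd
  | succ i ih => rw [Function.iterate_succ_apply']; exact h.map _ ih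

/-- Unless `d` and `p d` are mutual targets, `d + p d` increases along the chain. Clusters can
therefore take part in the slots indexed by these sums in the order in which they occur in the
chain. -/
theorem IsTargetMap.lt_of_ne (h : IsTargetMap p S N) {d : ℕ} (hd : d ∈ S) (hne : p (p d) ≠ d) :
    d + p d < p d + p (p d) := by
  have := h.le_twice d hd
  omega

theorem IsTargetMap.sum_le (h : IsTargetMap p S N) {d : ℕ} (hd : d ∈ S) : d + p d ≤ 2 * N := by
  have := h.le d hd
  have := h.le _ (h.map d hd)
  omega

/-- The sums `d + p d` are bounded, so the chain ends in a pair of mutual targets. -/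
theorem IsTargetMap.mutual_iterate (h : IsTargetMap p S N) {d : ℕ} (hd : d ∈ S) :
    p (p (p^[2 * N + 1] d)) = p^[2 * N + 1] d := by
  have key : ∀ i, p (p (p^[i] d)) = p^[i] d ∨ i ≤ p^[i] d + p (p^[i] d) := by
    intro i
    induction i with
    | zero => right; omega
    | succ i ih =>
      rw [Function.iterate_succ_apply']
      by_cases hm : p (p (p^[i] d)) = p^[i] d
      · left; rw [hm]
      · right
        have := h.lt_of_ne (h.iterate hd i) hm
        rcases ih with ih | ih
        · exact absurd ih hm
        · omega
  rcases key (2 * N + 1) with hk | hk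
  · exact hk
  · have := h.sum_le (h.iterate hd (2 * N + 1))
    omega

theorem IsTargetMap.limitName_target (h : IsTargetMap p S N) {d : ℕ} (hd : d ∈ S) :
    limitName p N (p d) = limitName p N d := by
  unfold limitName
  rw [← Function.iterate_succ_apply, Function.iterate_succ_apply', h.mutual_iterate hd, max_comm]

theorem IsTargetMap.limitName_iterate (h : IsTargetMap p S N) {d : ℕ} (hd : d ∈ S) (i : ℕ) :
    limitName p N (p^[i] d) = limitName p N d := by
  induction i with
  | zero => rfl
  | succ i ih => rw [Function.iterate_succ_apply', h.limitName_target (h.iterate hd i), ih]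

theorem limitName_of_mutual {d : ℕ} (hd : p (p d) = d) : limitName p N d = max d (p d) := by
  have key : ∀ i, p^[i] d = d ∨ p^[i] d = p d := by
    intro i
    induction i with
    | zero => exact Or.inl rfl
    | succ i ih =>
      rw [Function.iterate_succ_apply']
      rcases ih with ih | ih
      · rw [ih]; exact Or.inr rfl
      · rw [ih, hd]; exact Or.inl rfl
  unfold limitName
  rcases key (2 * N + 1) with hk | hk
  · rw [hk]
  · rw [hk, hd, max_comm]

theorem IsTargetMap.exists_limitName_eq (h : IsTargetMap p S N) {d : ℕ} (hd : d ∈ S) :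
    ∃ i, limitName p N d = p^[i] d ∧ p (p (p^[i] d)) = p^[i] d := by
  have hm := h.mutual_iterate hd
  rcases max_choice (p^[2 * N + 1] d) (p (p^[2 * N + 1] d)) with hk | hk
  · exact ⟨2 * N + 1, hk, hm⟩
  · refine ⟨2 * N + 2, ?_, ?_⟩
    · rw [Function.iterate_succ_apply']; exact hk
    · rw [Function.iterate_succ_apply', hm]

theorem IsTargetMap.limitName_mem (h : IsTargetMap p S N) {d : ℕ} (hd : d ∈ S) :
    limitName p N d ∈ S := by
  obtain ⟨i, hi, -⟩ := h.exists_limitName_eq hd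
  rw [hi]; exact h.iterate hd i

theorem IsTargetMap.limitName_limitName (h : IsTargetMap p S N) {d : ℕ} (hd : d ∈ S) :
    limitName p N (limitName p N d) = limitName p N d := by
  obtain ⟨i, hi, -⟩ := h.exists_limitName_eq hd
  conv_lhs => rw [hi]
  exact h.limitName_iterate hd i

/-- If `q` is a partial version of `p`, undefined values being `0`, then the limit computed
with `q` is undefined or leads to the same limit under `p`. -/
theorem IsTargetMap.limitName_partial (h : IsTargetMap p S N) {q : ℕ → ℕ}
    (hq : ∀ d, q d = p d ∨ q d = 0) (h0 : q 0 = 0) {d : ℕ} (hd : d ∈ S) :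
    limitName q N d = 0 ∨ limitName p N (limitName q N d) = limitName p N d := by
  have key : ∀ i, q^[i] d = p^[i] d ∨ q^[i] d = 0 := by
    intro i
    induction i with
    | zero => exact Or.inl rfl
    | succ i ih =>
      rw [Function.iterate_succ_apply', Function.iterate_succ_apply']
      rcases ih with ih | ih
      · rw [ih]; exact hq _
      · rw [ih]; exact Or.inr h0
  have hl : limitName q N d = max (q^[2 * N + 1] d) (q (q^[2 * N + 1] d)) := rfl
  rcases key (2 * N + 1) with hk | hk
  · rw [hk] at hl
    right
    rcases hq (p^[2 * N + 1] d) with hz | hz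
    · rw [hl, hz]; exact h.limitName_limitName hd
    · rw [hl, hz, Nat.max_zero]; exact h.limitName_iterate hd _
  · left; rw [hl, hk, h0]; rfl

theorem IsTargetMap.limitName_congr (h : IsTargetMap p S N) {q : ℕ → ℕ} {d : ℕ} (hd : d ∈ S)
    (hq : ∀ e ∈ S, limitName p N e = limitName p N d → q e = p e) :
    limitName q N d = limitName p N d := by
  have key : ∀ i, q^[i] d = p^[i] d := by
    intro i
    induction i with
    | zero => rfl
    | succ i ih =>
      rw [Function.iterate_succ_apply', Function.iterate_succ_apply', ih]
      exact hq _ (h.iterate hd i) (h.limitName_iterate hd i)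
  unfold limitName
  rw [key, hq _ (h.iterate hd _) (h.limitName_iterate hd _)]

end Chain

/-! ### Clusterings of the input graph -/

section Clustering

variable {G : InputGraph} {c : G.V → ℕ} {N : ℕ}

theorem mem_list {p : G.V → Prop} {v : G.V} : v ∈ G.list p ↔ p v := by
  classical
  simp [InputGraph.list]

theorem mem_nbrIds {v : G.V} {w : ℕ} : w ∈ G.nbrIds v ↔ ∃ u, G.graph.Adj v u ∧ u.1 = w := by
  simp only [InputGraph.nbrIds, List.mem_map, mem_list]

/-- The true entry of a vertex. -/
noncomputable def entry (G : InputGraph) (v : G.V) : Entry := (v.1, G.input v, G.nbrIds v)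

/-- The true fact about a vertex, when `c` gives the name of the cluster of every vertex. -/
noncomputable def fact (c : G.V → ℕ) (v : G.V) : Fact := (c v, entry G v)

/-- The subgraph of the edges within clusters. -/
def inner (c : G.V → ℕ) : SimpleGraph G.V where
  Adj v w := G.graph.Adj v w ∧ c v = c w
  symm := ⟨fun _ _ h => ⟨h.1.symm, h.2.symm⟩⟩
  loopless := ⟨fun _ h => h.1.ne rfl⟩

/-- Every cluster is connected and bears the name of one of its vertices, its root. -/
def IsClustering (c : G.V → ℕ) : Prop :=
  ∀ v, ∃ h : c v ∈ G.ids, (inner c).Reachable ⟨c v, h⟩ v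

theorem eq_of_reachable {v w : G.V} (h : (inner c).Reachable v w) : c v = c w := by
  obtain ⟨p⟩ := h
  induction p with
  | nil => rfl
  | cons h _ ih => exact h.2.trans ih

theorem IsClustering.reachable (hc : IsClustering c) {v w : G.V} (h : c v = c w) :
    (inner c).Reachable v w := by
  obtain ⟨h1, h2⟩ := hc v
  obtain ⟨h3, h4⟩ := hc w
  refine h2.symm.trans ?_
  simp only [h]
  exact h4

theorem IsClustering.pos (hc : IsClustering c) (v : G.V) : 1 ≤ c v :=
  G.ids_pos _ (hc v).1

theorem IsClustering.le (hc : IsClustering c) (hN : G.BoundedBy N) (v : G.V) : c v ≤ N :=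
  hN _ (hc v).1

theorem isClustering_id : IsClustering (fun v : G.V => v.1) :=
  fun v => ⟨v.2, SimpleGraph.Reachable.refl _⟩

/-- The names of the clusters adjacent to cluster `d`. -/
noncomputable def neighbours (c : G.V → ℕ) (d : ℕ) : Finset ℕ := by
  classical
  exact (Finset.univ.filter (fun w => c w ≠ d ∧ ∃ v, c v = d ∧ G.graph.Adj v w)).image c

theorem mem_neighbours {d e : ℕ} :
    e ∈ neighbours c d ↔ ∃ v w, c v = d ∧ c w = e ∧ c w ≠ d ∧ G.graph.Adj v w := by
  classical
  simp only [neighbours, Finset.mem_image, Finset.mem_filter, Finset.mem_univ, true_and]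
  constructor
  · rintro ⟨w, ⟨h1, v, h2, h3⟩, h4⟩; exact ⟨v, w, h2, h4, h1, h3⟩
  · rintro ⟨v, w, h2, h4, h1, h3⟩; exact ⟨w, ⟨h1, v, h2, h3⟩, h4⟩

/-- The largest name of a cluster adjacent to cluster `d`. -/
noncomputable def trueTarget (c : G.V → ℕ) (d : ℕ) : ℕ := (neighbours c d).sup id

/-- There is more than one cluster. -/
def Several (c : G.V → ℕ) : Prop := ∃ v w, c v ≠ c w

theorem Several.neighbours_nonempty (hs : Several c) (v : G.V) : (neighbours c (c v)).Nonempty := by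
  obtain ⟨w, hw⟩ : ∃ w, c w ≠ c v := by
    obtain ⟨a, b, hab⟩ := hs
    by_cases h : c a = c v
    · exact ⟨b, fun h' => hab (h.trans h'.symm)⟩
    · exact ⟨a, h⟩
  obtain ⟨p⟩ := G.connected.preconnected v w
  obtain ⟨x, -, hx1, hx2⟩ := p.exists_boundary_dart {u | c u = c v} rfl hw
  exact ⟨c x.snd, mem_neighbours.2 ⟨x.fst, x.snd, hx1, rfl, hx2, x.adj⟩⟩

theorem Several.trueTarget_mem (hs : Several c) (v : G.V) :
    trueTarget c (c v) ∈ neighbours c (c v) := by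
  obtain ⟨e, he, h⟩ := (neighbours c (c v)).exists_mem_eq_sup (hs.neighbours_nonempty v) id
  unfold trueTarget
  rw [h]; exact he

theorem Several.exists_adj (hs : Several c) (v : G.V) :
    ∃ a b, c a = c v ∧ c b = trueTarget c (c v) ∧ G.graph.Adj a b := by
  obtain ⟨a, b, h1, h2, -, h3⟩ := mem_neighbours.1 (hs.trueTarget_mem v)
  exact ⟨a, b, h1, h2, h3⟩

theorem Several.isTargetMap (hs : Several c) (hc : IsClustering c) (hN : G.BoundedBy N) :
    IsTargetMap (trueTarget c) (Set.range c) N where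
  map := by
    rintro _ ⟨v, rfl⟩
    obtain ⟨a, b, -, h, -⟩ := hs.exists_adj v
    exact ⟨b, h⟩
  le := by rintro _ ⟨v, rfl⟩; exact hc.le hN v
  le_twice := by
    rintro _ ⟨v, rfl⟩
    obtain ⟨a, b, h1, h2, h3, h4⟩ := mem_neighbours.1 (hs.trueTarget_mem v)
    refine Finset.le_sup (f := id) (b := c v) (mem_neighbours.2 ⟨b, a, h2, h1, ?_, h4.symm⟩)
    rw [← h2, h1]; exact h3.symm

/-- The names of the clusters after a phase: clusters are merged if their chains of targets end in
the same pair. -/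
noncomputable def merged (c : G.V → ℕ) (N : ℕ) (v : G.V) : ℕ := limitName (trueTarget c) N (c v)

theorem Several.reachable_merged (hs : Several c) (hc : IsClustering c) (hN : G.BoundedBy N)
    (v : G.V) (i : ℕ) {w : G.V} (hw : c w = (trueTarget c)^[i] (c v)) :
    (inner (merged c N)).Reachable v w := by
  have hT := hs.isTargetMap hc hN
  have hmono : ∀ {x y : G.V}, c x = c y → (inner (merged c N)).Reachable x y := by
    intro x y h
    refine (hc.reachable h).mono ?_
    intro a b hab
    exact ⟨hab.1, congrArg (limitName (trueTarget c) N) hab.2⟩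
  induction i generalizing w with
  | zero => exact hmono hw.symm
  | succ i ih =>
    obtain ⟨u, hu⟩ := hT.iterate ⟨v, rfl⟩ i
    obtain ⟨a, b, h1, h2, h3⟩ := hs.exists_adj u
    rw [Function.iterate_succ_apply', ← hu] at hw
    refine (ih hu).trans ((hmono h1.symm).trans ?_)
    refine SimpleGraph.Reachable.trans (SimpleGraph.Adj.reachable ⟨h3, ?_⟩)
      (hmono (h2.trans hw.symm))
    unfold merged
    rw [h2, h1, hT.limitName_target ⟨u, rfl⟩]

theorem Several.isClustering_merged (hs : Several c) (hc : IsClustering c)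
    (hN : G.BoundedBy N) : IsClustering (merged c N) := by
  intro v
  have hT := hs.isTargetMap hc hN
  obtain ⟨i, hi, -⟩ := hT.exists_limitName_eq (d := c v) ⟨v, rfl⟩
  obtain ⟨w, hw⟩ := hT.limitName_mem (d := c v) ⟨v, rfl⟩
  obtain ⟨hr, hrw⟩ := hc w
  have e : merged c N v = c w := hw.symm
  refine ⟨e ▸ hr, ?_⟩
  have := (hs.reachable_merged hc hN v i (w := ⟨c w, hr⟩)
    ((eq_of_reachable hrw).trans (hw.trans hi))).symm
  simp only [e]
  exact this

/-- Every new cluster consists of at least two old ones. -/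
theorem Several.card_merged (hs : Several c) (hc : IsClustering c) (hN : G.BoundedBy N) :
    2 * (Finset.univ.image (merged c N)).card ≤ (Finset.univ.image c).card := by
  classical
  have hT := hs.isTargetMap hc hN
  have himg : Finset.univ.image (merged c N) =
      (Finset.univ.image c).image (limitName (trueTarget c) N) := by
    rw [Finset.image_image]; rfl
  rw [himg]
  refine Finset.mul_card_image_le_card _ 2 fun e he => ?_
  obtain ⟨d, hd, rfl⟩ := Finset.mem_image.1 he
  obtain ⟨v, -, rfl⟩ := Finset.mem_image.1 hd
  obtain ⟨a, b, h1, h2, h3, h4⟩ := mem_neighbours.1 (hs.trueTarget_mem v)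
  refine Finset.one_lt_card.2 ⟨c v, ?_, trueTarget c (c v), ?_, fun h => h3 (h2.trans h.symm)⟩
  · simp
  · rw [Finset.mem_filter, hT.limitName_target ⟨v, rfl⟩, ← h2]
    exact ⟨Finset.mem_image_of_mem _ (Finset.mem_univ _), rfl⟩

/-! ### What the members of a cluster compute from the facts that they know -/

variable {K : List Fact}

/-- All facts are true. -/
def Sound (c : G.V → ℕ) (K : List Fact) : Prop := ∀ f ∈ K, ∃ v, f = fact c v

/-- The facts about cluster `d` and about its neighbours are among `K`. -/
def Covers (c : G.V → ℕ) (K : List Fact) (d : ℕ) : Prop :=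
  ∀ v, c v = d → fact c v ∈ K ∧ ∀ w, G.graph.Adj v w → fact c w ∈ K

theorem Sound.mem_adjacentNames (hK : Sound c K) {d e : ℕ} (h : e ∈ adjacentNames K d) :
    e ∈ neighbours c d := by
  simp only [adjacentNames, List.mem_map, List.mem_filter, decide_eq_true_eq] at h
  obtain ⟨g, ⟨hg, hne, f, hf, hfd, hgf⟩, rfl⟩ := h
  obtain ⟨w, rfl⟩ := hK g hg
  obtain ⟨v, rfl⟩ := hK f hf
  obtain ⟨u, hu, huw⟩ := mem_nbrIds.1 hgf
  obtain rfl : u = w := Subtype.ext huw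
  exact mem_neighbours.2 ⟨v, u, hfd, rfl, hne, hu⟩

theorem foldr_max_le {l : List ℕ} {b : ℕ} : l.foldr max 0 ≤ b ↔ ∀ x ∈ l, x ≤ b := by
  induction l with
  | nil => simp
  | cons a l ih => simp [ih]

theorem Sound.target_eq (hK : Sound c K) {d : ℕ} (h : Covers c K d) :
    target K d = trueTarget c d := by
  have hsur : Surrounded K d := by
    rintro f hf rfl w hw
    obtain ⟨v, rfl⟩ := hK f hf
    obtain ⟨u, hu, rfl⟩ := mem_nbrIds.1 hw
    exact ⟨fact c u, (h v rfl).2 u hu, rfl⟩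
  rw [target, if_pos hsur]
  apply le_antisymm
  · exact foldr_max_le.2 fun x hx => Finset.le_sup (f := id) (hK.mem_adjacentNames hx)
  · refine Finset.sup_le fun e he => foldr_max_le.1 le_rfl _ ?_
    obtain ⟨v, w, hv, hw, hne, hvw⟩ := mem_neighbours.1 he
    simp only [adjacentNames, List.mem_map, List.mem_filter, decide_eq_true_eq]
    exact ⟨fact c w, ⟨(h v hv).2 w hvw, hne, fact c v, (h v hv).1, hv,
      mem_nbrIds.2 ⟨w, hvw, rfl⟩⟩, hw⟩

theorem Sound.target_eq_or (hK : Sound c K) (hc : IsClustering c) (d : ℕ) :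
    target K d = trueTarget c d ∨ target K d = 0 := by
  by_cases hsur : Surrounded K d
  swap
  · right; rw [target, if_neg hsur]
  by_cases hex : ∃ f ∈ K, f.1 = d
  · left
    obtain ⟨f, hf, rfl⟩ := hex
    obtain ⟨v, rfl⟩ := hK f hf
    have hnbr : ∀ {a b : G.V}, fact c a ∈ K → c a = c v → G.graph.Adj a b → fact c b ∈ K := by
      intro a b ha hav hab
      obtain ⟨g, hg, hgb⟩ := hsur _ ha hav b.1 (mem_nbrIds.2 ⟨b, hab, rfl⟩)
      obtain ⟨u, rfl⟩ := hK g hg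
      obtain rfl : u = b := Subtype.ext hgb
      exact hg
    have hall : ∀ w, (inner c).Reachable v w → fact c w ∈ K := by
      rintro w ⟨p⟩
      suffices ∀ {x y : G.V} (p : (inner c).Walk x y), fact c x ∈ K → c x = c v → fact c y ∈ K from
        this p hf rfl
      intro x y p
      induction p with
      | nil => exact fun h _ => h
      | cons h _ ih => exact fun hx hxv => ih (hnbr hx hxv h.1) (h.2.symm.trans hxv)
    refine hK.target_eq fun w hw => ?_
    have hwK := hall w (hc.reachable hw.symm)
    exact ⟨hwK, fun x hx => hnbr hwK hw hx⟩
  · right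
    rw [target, if_pos hsur]
    have : adjacentNames K d = [] := by
      refine List.eq_nil_iff_forall_not_mem.2 fun e he => hex ?_
      simp only [adjacentNames, List.mem_map, List.mem_filter, decide_eq_true_eq] at he
      obtain ⟨g, ⟨-, -, f, hf, hfd, -⟩, -⟩ := he
      exact ⟨f, hf, hfd⟩
    rw [this]; rfl

/-- Clusters about which too little is known have target `0`, which cannot lead to a wrong new name,
so that knowledge about the clusters of the same new cluster suffices. -/
theorem Sound.newName_eq (hK : Sound c K) (hs : Several c) (hc : IsClustering c)
    (hN : G.BoundedBy N) {v : G.V}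
    (h : ∀ u, merged c N u = merged c N v → Covers c K (c u)) :
    newName K N (c v) = merged c N v := by
  refine (hs.isTargetMap hc hN).limitName_congr ⟨v, rfl⟩ ?_
  rintro _ ⟨u, rfl⟩ hu
  exact hK.target_eq (h u hu)

theorem Sound.mem_newFacts (hK : Sound c K) (hs : Several c) (hc : IsClustering c)
    (hN : G.BoundedBy N) {v : G.V}
    (h : ∀ u, merged c N u = merged c N v → Covers c K (c u)) {f : Fact} :
    f ∈ newFacts K N (c v) ↔
      ∃ u, merged c N u = merged c N v ∧ f = fact (merged c N) u := by
  have hT := hs.isTargetMap hc hN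
  have hv := hK.newName_eq hs hc hN h
  have h0 : target K 0 = 0 := by
    rcases hK.target_eq_or hc 0 with h0 | h0
    · rw [h0]
      refine Finset.sup_eq_bot_iff _ _ |>.2 fun e he => ?_
      obtain ⟨a, -, ha, -⟩ := mem_neighbours.1 he
      have := hc.pos a
      omega
    · exact h0
  simp only [newFacts, List.mem_map, List.mem_filter, decide_eq_true_eq, hv]
  constructor
  · rintro ⟨g, ⟨hg, hgv⟩, rfl⟩
    obtain ⟨u, rfl⟩ := hK g hg
    have huv : merged c N u = merged c N v := by
      rcases hT.limitName_partial (fun d => hK.target_eq_or hc d) h0 (d := c u) ⟨u, rfl⟩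
        with h1 | h1
      · have h2 : newName K N (c u) = 0 := h1
        have h3 := (hs.isClustering_merged hc hN).pos v
        rw [show newName K N (c u) = merged c N v from hgv] at h2
        omega
      · rw [show limitName (target K) N (c u) = merged c N v from hgv] at h1
        exact h1.symm.trans (hT.limitName_limitName ⟨v, rfl⟩)
    exact ⟨u, huv, by rw [← huv]; rfl⟩
  · rintro ⟨u, hu, rfl⟩
    refine ⟨fact c u, ⟨(h u hu (u) rfl).1, ?_⟩, by rw [← hu]; rfl⟩
    have := hK.newName_eq hs hc hN (v := u) (fun w hw => h w (hw.trans hu))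
    exact this.trans hu

/-! ### Layers of a cluster -/

/-- The root of the cluster of `v`. -/
noncomputable def root (c : G.V → ℕ) (v : G.V) : G.V := by
  classical
  exact if h : c v ∈ G.ids then ⟨c v, h⟩ else v

/-- The distance of `v` from the root within its cluster. -/
noncomputable def depth (c : G.V → ℕ) (v : G.V) : ℕ := (inner c).dist (root c v) v

theorem IsClustering.reachable_root (hc : IsClustering c) (v : G.V) :
    (inner c).Reachable (root c v) v := by
  obtain ⟨h1, h2⟩ := hc v
  rw [root, dif_pos h1]; exact h2

theorem IsClustering.val_root (hc : IsClustering c) (v : G.V) : (root c v).1 = c v := by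
  rw [root, dif_pos (hc v).1]

theorem root_congr (hc : IsClustering c) {v w : G.V} (h : c v = c w) : root c v = root c w :=
  Subtype.ext (by rw [hc.val_root, hc.val_root, h])

theorem card_le_of_boundedBy (hN : G.BoundedBy N) : Fintype.card G.V ≤ N := by
  have h : G.ids ⊆ Finset.Icc 1 N := fun i hi => Finset.mem_Icc.2 ⟨G.ids_pos i hi, hN i hi⟩
  have := Finset.card_le_card h
  rw [Fintype.card_coe]
  simpa using this

theorem IsClustering.depth_lt (hc : IsClustering c) (hN : G.BoundedBy N) (v : G.V) :
    depth c v < N := by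
  obtain ⟨p, hp, hl⟩ := (hc.reachable_root v).exists_path_of_dist
  have := hp.length_lt
  have := card_le_of_boundedBy hN
  unfold depth
  omega

theorem IsClustering.eq_root_of_depth_eq_zero (hc : IsClustering c) {v : G.V}
    (h : depth c v = 0) : v = root c v :=
  ((hc.reachable_root v).dist_eq_zero_iff.1 h).symm

theorem IsClustering.exists_depth_eq (hc : IsClustering c) {v : G.V} {i : ℕ}
    (h : depth c v = i + 1) : ∃ u, G.graph.Adj v u ∧ c u = c v ∧ depth c u = i := by
  have key : ∀ r, ∀ p : (inner c).Walk v r, p.length = i + 1 →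
      ∃ u, (inner c).Adj v u ∧ ∃ q : (inner c).Walk u r, q.length = i := by
    rintro r (_ | ⟨hvu, q⟩) hp
    · simp at hp
    · exact ⟨_, hvu, q, by simpa using hp⟩
  obtain ⟨p, hp⟩ := (hc.reachable_root v).symm.exists_walk_length_eq_dist
  rw [SimpleGraph.dist_comm, show (inner c).dist (root c v) v = i + 1 from h] at hp
  obtain ⟨u, hvu, q, hq⟩ := key _ p hp
  have hr : root c u = root c v := root_congr hc hvu.2.symm
  refine ⟨u, hvu.1, hvu.2.symm, le_antisymm ?_ ?_⟩
  · rw [depth, hr, SimpleGraph.dist_comm, ← hq]; exact SimpleGraph.dist_le q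
  · obtain ⟨q', hq'⟩ := (hc.reachable_root u).symm.exists_walk_length_eq_dist
    have h1 := SimpleGraph.dist_le (SimpleGraph.Walk.cons hvu (q'.copy rfl hr))
    rw [SimpleGraph.dist_comm, show (inner c).dist (root c v) v = i + 1 from h] at h1
    simp only [SimpleGraph.Walk.length_cons, SimpleGraph.Walk.length_copy, hq'] at h1
    rw [SimpleGraph.dist_comm] at h1
    unfold depth
    omega

theorem Sound.mem_ball (hK : Sound c K) {r : G.V} (hr : c r = r.1)
    (h : ∀ v, c v = c r → fact c v ∈ K) (k : ℕ) (w : G.V) :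
    w.1 ∈ ball K (c r) k ↔ ∃ p : (inner c).Walk w r, p.length ≤ k := by
  induction k generalizing w with
  | zero =>
    simp only [ball, Function.iterate_zero, id, List.mem_singleton, hr]
    constructor
    · intro hw
      obtain rfl : w = r := Subtype.ext hw
      exact ⟨.nil, le_rfl⟩
    · rintro ⟨p, hp⟩
      rw [SimpleGraph.Walk.eq_of_length_eq_zero (Nat.le_zero.1 hp)]
  | succ k ih =>
    have e : ball K (c r) (k + 1) = (K.filter (fun g => g.1 = c r ∧
        (g.2.1 ∈ ball K (c r) k ∨ ∃ f ∈ K, (f.1 = c r ∧ f.2.1 ∈ ball K (c r) k) ∧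
          g.2.1 ∈ f.2.2.2))).map (fun g => g.2.1) := Function.iterate_succ_apply' _ _ _
    rw [e]
    simp only [List.mem_map, List.mem_filter, decide_eq_true_eq]
    constructor
    · rintro ⟨g, ⟨hg, hgc, hg'⟩, hgw⟩
      obtain ⟨w', rfl⟩ := hK g hg
      obtain rfl : w' = w := Subtype.ext hgw
      rcases hg' with hg' | ⟨f, hf, ⟨hfc, hfb⟩, hgf⟩
      · obtain ⟨p, hp⟩ := (ih w').1 hg'
        exact ⟨p, by omega⟩
      · obtain ⟨u, rfl⟩ := hK f hf
        obtain ⟨p, hp⟩ := (ih u).1 hfb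
        obtain ⟨x, hx, hxw⟩ := mem_nbrIds.1 hgf
        obtain rfl : x = w' := Subtype.ext hxw
        have hadj : (inner c).Adj x u := ⟨hx.symm, hgc.trans hfc.symm⟩
        exact ⟨.cons hadj p, by simpa using hp⟩
    · rintro ⟨p, hp⟩
      have hw : c w = c r := eq_of_reachable ⟨p⟩
      refine ⟨fact c w, ⟨h w hw, hw, ?_⟩, rfl⟩
      cases p with
      | nil => exact Or.inl ((ih _).2 ⟨.nil, by simp⟩)
      | @cons _ u _ hwu q =>
        have hu : c u = c r := eq_of_reachable ⟨q⟩
        refine Or.inr ⟨fact c u, h u hu, ⟨hu, (ih u).2 ⟨q, by simpa using hp⟩⟩, ?_⟩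
        exact mem_nbrIds.2 ⟨w, hwu.1.symm, rfl⟩

theorem Sound.layer_eq (hK : Sound c K) (hc : IsClustering c) (hN : G.BoundedBy N) {v : G.V}
    (h : ∀ w, c w = c v → fact c w ∈ K) : layer K (c v) v.1 N = depth c v := by
  have hr : c (root c v) = c v := eq_of_reachable (hc.reachable_root v)
  have hmem : ∀ k, v.1 ∉ ball K (c v) k ↔ k < depth c v := by
    intro k
    rw [← hr, hK.mem_ball (hr.trans (hc.val_root v).symm) (fun w hw => h w (hw.trans hr)) k v,
      ← not_le, not_iff_not]
    constructor
    · rintro ⟨p, hp⟩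
      rw [depth, SimpleGraph.dist_comm]
      exact (SimpleGraph.dist_le p).trans hp
    · intro hk
      obtain ⟨p, hp⟩ := (hc.reachable_root v).symm.exists_walk_length_eq_dist
      rw [SimpleGraph.dist_comm] at hp
      exact ⟨p, hp.trans_le hk⟩
  have hlt := hc.depth_lt hN v
  simp only [layer, hmem]
  refine Eq.trans ?_ (Finset.card_range (depth c v))
  rw [← List.toFinset_card_of_nodup (List.nodup_range.filter _)]
  congr 1
  ext k
  simp only [List.mem_toFinset, List.mem_filter, List.mem_range, decide_eq_true_eq,
    Finset.mem_range]
  omega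

theorem Sound.not_closed (hK : Sound c K) (hs : Several c) {v : G.V}
    (h : ∀ w, c w = c v → fact c w ∈ K) : ¬ Closed K (c v) := by
  intro hcl
  obtain ⟨a, b, h1, h2, h3, h4⟩ := mem_neighbours.1 (hs.trueTarget_mem v)
  obtain ⟨g, hg, hg1, hg2⟩ := hcl _ (h a h1) h1 b.1 (mem_nbrIds.2 ⟨b, h4, rfl⟩)
  obtain ⟨u, rfl⟩ := hK g hg
  obtain rfl : u = b := Subtype.ext hg2
  exact h3 hg1

theorem Sound.closed (hK : Sound c K) (hs : ¬ Several c) (v : G.V) (h : ∀ w, fact c w ∈ K) :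
    Closed K (c v) := by
  simp only [Several, not_exists, not_not] at hs
  rintro f hf - w hw
  obtain ⟨x, rfl⟩ := hK f hf
  obtain ⟨u, hu, rfl⟩ := mem_nbrIds.1 hw
  exact ⟨fact c u, h u, hs _ _, rfl⟩

theorem Sound.entries_eq (hK : Sound c K) (hN : G.BoundedBy N) (h : ∀ w, fact c w ∈ K) :
    entries K N = G.code := by
  have h1 : ∀ i, ((K.filter (fun f => f.2.1 = i)).map Prod.snd).head? =
      (if hi : i ∈ G.ids then some (⟨i, hi⟩ : G.V) else none).map (entry G) := by
    intro i
    have hmem : ∀ e ∈ (K.filter (fun f => f.2.1 = i)).map Prod.snd, ∃ w : G.V, w.1 = i ∧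
        e = entry G w := by
      intro e he
      simp only [List.mem_map, List.mem_filter, decide_eq_true_eq] at he
      obtain ⟨f, ⟨hf, hfi⟩, rfl⟩ := he
      obtain ⟨w, rfl⟩ := hK f hf
      exact ⟨w, hfi, rfl⟩
    split_ifs with hi
    · have hne : (K.filter (fun f => f.2.1 = i)).map Prod.snd ≠ [] := by
        refine List.ne_nil_of_mem (a := entry G ⟨i, hi⟩) ?_
        simp only [List.mem_map, List.mem_filter, decide_eq_true_eq]
        exact ⟨fact c ⟨i, hi⟩, ⟨h _, rfl⟩, rfl⟩
      rw [List.head?_eq_some_head hne]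
      obtain ⟨w, hw, hwe⟩ := hmem _ (List.head_mem hne)
      obtain rfl : w = ⟨i, hi⟩ := Subtype.ext hw
      rw [hwe]; rfl
    · have : (K.filter (fun f => f.2.1 = i)).map Prod.snd = [] := by
        refine List.eq_nil_iff_forall_not_mem.2 fun e he => ?_
        obtain ⟨w, hw, -⟩ := hmem e he
        exact hi (hw ▸ w.2)
      rw [this]; rfl
  have h2 : (List.range (N + 1)).filterMap
      (fun i => if hi : i ∈ G.ids then some (⟨i, hi⟩ : G.V) else none) =
      G.list (fun _ => True) := by
    refine List.SortedLT.eq_of_mem_iff ?_ (Finset.sortedLT_sort _) fun v => ?_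
    · refine (List.pairwise_lt_range.filterMap _ ?_).sortedLT
      intro i j hij a ha b hb
      split_ifs at ha hb
      simp only [Option.some.injEq] at ha hb
      subst ha hb
      exact hij
    · refine iff_of_true ?_ (mem_list.2 trivial)
      simp only [List.mem_filterMap, List.mem_range]
      exact ⟨v.1, Nat.lt_succ_of_le (hN _ v.2), by simp⟩
  unfold entries InputGraph.code
  rw [← h2, List.map_filterMap]
  simp only [h1]
  rfl

end Clustering

end Sleeping.Gather


namespace Sleeping.Gather

/-! ### Executions of the gathering algorithm -/

theorem slotLength_pos (N : ℕ) : 0 < slotLength N := by unfold slotLength; omega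

theorem phaseLength_pos (N : ℕ) : 0 < phaseLength N := by
  unfold phaseLength middle
  exact Nat.mul_pos (by omega) (slotLength_pos N)

theorem wait_lt (s : State) : wait s < phaseLength s.1 := by
  have hpos := phaseLength_pos s.1
  obtain ⟨d, hd, hw⟩ : ∃ d < phaseLength s.1, Wakes s (s.2.2.2.1 + d) := by
    set F := phaseLength s.1 with hF
    refine ⟨(F - s.2.2.2.1 % F) % F, Nat.mod_lt _ hpos, Or.inl ?_⟩
    rw [← hF]
    have h1 : s.2.2.2.1 % F < F := Nat.mod_lt _ hpos
    have : (s.2.2.2.1 % F + (F - s.2.2.2.1 % F)) % F = 0 := by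
      rw [Nat.add_sub_cancel' h1.le, Nat.mod_self]
    rw [← this]
    simp [Nat.add_mod]
  have := List.findIdx_lt_length_of_exists (xs := List.range (phaseLength s.1))
    (p := fun d => decide (Wakes s (s.2.2.2.1 + d))) ⟨d, by simpa using hd, by simpa using hw⟩
  simpa [wait] using this

theorem wakes_wait (s : State) : Wakes s (s.2.2.2.1 + wait s) := by
  have h : (List.range (phaseLength s.1)).findIdx (fun d => decide (Wakes s (s.2.2.2.1 + d))) <
    (List.range (phaseLength s.1)).length := by
    rw [List.length_range]; exact wait_lt s
  have := List.findIdx_getElem (w := h)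
  simpa [wait] using this

theorem not_wakes_of_lt_wait {s : State} {d : ℕ} (hd : d < wait s) :
    ¬ Wakes s (s.2.2.2.1 + d) := by
  have := List.not_of_lt_findIdx (p := fun d => decide (Wakes s (s.2.2.2.1 + d))) hd
  simpa using this

section Run

variable (f : List Entry × ℕ → ℕ) (G : InputGraph) (N : ℕ)

/-- The memory of vertex `v` at the beginning of round `t`. -/
noncomputable def mem (t : ℕ) (v : G.V) : State := memory ((algorithm f).run G N t v).state

/-- The facts that vertex `v` knows at the beginning of round `t`. -/
noncomputable def known (t : ℕ) (v : G.V) : List Fact := (mem f G N t v).2.2.2.2.2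

/-- Vertex `v` is awake in round `t`. -/
def AwakeAt (t : ℕ) (v : G.V) : Prop := (algorithm f).Awake ((algorithm f).run G N t v)

variable {f G N}

theorem mem_succ_of_not_awake {t : ℕ} {v : G.V} (h : ¬ AwakeAt f G N t v) :
    mem f G N (t + 1) v = mem f G N t v := by
  rw [mem, Algorithm.run_succ_of_not_awake h]; rfl

theorem mem_succ_of_awake {t : ℕ} {v : G.V} (h : AwakeAt f G N t v) :
    mem f G N (t + 1) v = next (mem f G N t v)
      ((algorithm f).received G ((algorithm f).run G N t) v) := by
  rw [mem, Algorithm.run_succ_of_awake h]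
  exact memory_codeMemory _

/-- The memory of a vertex keeps the parameters, and the timer of a vertex that has not terminated
shows the time until the next round in which the vertex wants to be awake. -/
theorem mem_invariant (t : ℕ) (v : G.V) :
    (mem f G N t v).1 = N ∧ (mem f G N t v).2.1 = v.1 ∧ (mem f G N t v).2.2.1 = G.input v ∧
    (mem f G N t v).2.2.2.1 ≤ t ∧ (result f (mem f G N t v) = none →
      ((algorithm f).run G N t v).timer + t = (mem f G N t v).2.2.2.1 + wait (mem f G N t v)) := by
  induction t with
  | zero =>
    have h : mem f G N 0 v = (N, v.1, G.input v, 0, 0, []) := memory_codeMemory _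
    have h2 : ((algorithm f).run G N 0 v).timer = wait (mem f G N 0 v) := rfl
    refine ⟨by rw [h], by rw [h], by rw [h], by rw [h], fun _ => ?_⟩
    rw [h2, h, Nat.zero_add]; rfl
  | succ t ih =>
    obtain ⟨h1, h2, h3, h4, h5⟩ := ih
    by_cases ha : AwakeAt f G N t v
    · have ht := h5 ha.1
      rw [ha.2, Nat.zero_add] at ht
      have e := mem_succ_of_awake ha
      have htimer : ((algorithm f).run G N (t + 1) v).timer = wait (mem f G N (t + 1) v) := by
        rw [mem, Algorithm.run_succ_of_awake ha]; rfl
      rw [htimer]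
      have hnext : (mem f G N (t + 1) v).1 = N ∧ (mem f G N (t + 1) v).2.1 = v.1 ∧
          (mem f G N (t + 1) v).2.2.1 = G.input v ∧ (mem f G N (t + 1) v).2.2.2.1 = t + 1 := by
        rw [e, next, ← ht]
        split_ifs with hz hz'
        · exact ⟨h1, h2, h3, by rw [hz]⟩
        · exact ⟨h1, h2, h3, rfl⟩
        · exact ⟨h1, h2, h3, rfl⟩
      refine ⟨hnext.1, hnext.2.1, hnext.2.2.1, hnext.2.2.2.le, fun _ => ?_⟩
      rw [hnext.2.2.2]; omega
    · rw [mem_succ_of_not_awake ha]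
      refine ⟨h1, h2, h3, h4.trans (Nat.le_succ t), fun hr => ?_⟩
      have ht := h5 hr
      have hne : ((algorithm f).run G N t v).timer ≠ 0 := fun h0 => ha ⟨hr, h0⟩
      rw [Algorithm.run_succ_of_not_awake ha]
      dsimp only
      omega

theorem awakeAt_iff {t : ℕ} {v : G.V} :
    AwakeAt f G N t v ↔ result f (mem f G N t v) = none ∧ Wakes (mem f G N t v) t := by
  obtain ⟨-, -, -, h4, h5⟩ := mem_invariant (f := f) (N := N) t v
  constructor
  · rintro ⟨h1, h2⟩
    have := h5 h1
    rw [h2, Nat.zero_add] at this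
    refine ⟨h1, ?_⟩
    have hw := wakes_wait (mem f G N t v)
    rwa [← this] at hw
  · rintro ⟨h1, h2⟩
    refine ⟨h1, ?_⟩
    have := h5 h1
    by_contra hne
    have hlt : t - (mem f G N t v).2.2.2.1 < wait (mem f G N t v) := by omega
    refine not_wakes_of_lt_wait hlt ?_
    rwa [Nat.add_sub_cancel' h4]

theorem time_eq_of_awake {t : ℕ} {v : G.V} (h : AwakeAt f G N t v) :
    (mem f G N t v).2.2.2.1 + wait (mem f G N t v) = t := by
  obtain ⟨-, -, -, -, h5⟩ := mem_invariant (f := f) (N := N) t v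
  have := h5 h.1
  rw [h.2] at this
  omega

theorem mem_received {t : ℕ} {v : G.V} {p : ℕ × ℕ} :
    p ∈ (algorithm f).received G ((algorithm f).run G N t) v ↔
      ∃ u, G.graph.Adj v u ∧ AwakeAt f G N t u ∧
        p = (u.1, ((algorithm f).run G N t u).state) := by
  simp only [Algorithm.received, List.mem_map, mem_list, AwakeAt]
  constructor
  · rintro ⟨u, ⟨h1, h2⟩, rfl⟩; exact ⟨u, h1, h2, rfl⟩
  · rintro ⟨u, h1, h2, rfl⟩; exact ⟨u, ⟨h1, h2⟩, rfl⟩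

theorem wakes_of_mod {t : ℕ} (v : G.V) (h : t % phaseLength N = 0) :
    Wakes (mem f G N t v) t := by
  obtain ⟨h1, -⟩ := mem_invariant (f := f) (N := N) t v
  left; rw [h1]; exact h

/-- In the rounds between two ends of phases the vertices exchange all that they know. -/
theorem mem_known_succ {t : ℕ} {v : G.V} {g : Fact} (ht : t % phaseLength N ≠ 0)
    (h : AwakeAt f G N t v) : g ∈ known f G N (t + 1) v ↔
      g ∈ known f G N t v ∨ ∃ u, G.graph.Adj v u ∧ AwakeAt f G N t u ∧ g ∈ known f G N t u := by
  obtain ⟨h1, -⟩ := mem_invariant (f := f) (N := N) t v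
  have h0 : t ≠ 0 := by rintro rfl; simp at ht
  rw [known, mem_succ_of_awake h, next, time_eq_of_awake h, if_neg h0, h1, if_neg ht]
  simp only [List.mem_append, List.mem_flatMap, mem_received]
  refine or_congr Iff.rfl ⟨?_, ?_⟩
  · rintro ⟨_, ⟨u, h2, h3, rfl⟩, h4⟩; exact ⟨u, h2, h3, h4⟩
  · rintro ⟨u, h2, h3, h4⟩; exact ⟨_, ⟨u, h2, h3, rfl⟩, h4⟩

theorem name_succ {t : ℕ} {v : G.V} (ht : t % phaseLength N ≠ 0) :
    (mem f G N (t + 1) v).2.2.2.2.1 = (mem f G N t v).2.2.2.2.1 := by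
  by_cases h : AwakeAt f G N t v
  · obtain ⟨h1, -⟩ := mem_invariant (f := f) (N := N) t v
    have h0 : t ≠ 0 := by rintro rfl; simp at ht
    rw [mem_succ_of_awake h, next, time_eq_of_awake h, if_neg h0, h1, if_neg ht]
  · rw [mem_succ_of_not_awake h]

theorem time_succ_ne_zero {t : ℕ} {v : G.V} (h : (mem f G N t v).2.2.2.1 ≠ 0 ∨ AwakeAt f G N t v) :
    (mem f G N (t + 1) v).2.2.2.1 ≠ 0 := by
  by_cases ha : AwakeAt f G N t v
  · rw [mem_succ_of_awake ha, next]
    split_ifs <;> simp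
  · rw [mem_succ_of_not_awake ha]
    exact h.resolve_right ha

variable {c : G.V → ℕ}

/-- The situation after the last round of a phase: a vertex knows its cluster and nothing else. -/
def PhaseStart (f : List Entry × ℕ → ℕ) (N : ℕ) (c : G.V → ℕ) (t : ℕ) : Prop :=
  ∀ v, (mem f G N t v).2.2.2.1 ≠ 0 ∧ (mem f G N t v).2.2.2.2.1 = c v ∧
    ∀ g, g ∈ known f G N t v ↔ ∃ u, c u = c v ∧ g = fact c u

/-- The situation during a phase: a vertex knows its cluster, and all that it knows is true. -/
def InPhase (f : List Entry × ℕ → ℕ) (N : ℕ) (c : G.V → ℕ) (t : ℕ) : Prop :=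
  ∀ v, (mem f G N t v).2.2.2.1 ≠ 0 ∧ (mem f G N t v).2.2.2.2.1 = c v ∧
    Sound c (known f G N t v) ∧ ∀ w, c w = c v → fact c w ∈ known f G N t v

theorem PhaseStart.inPhase {t : ℕ} (h : PhaseStart f N c t) : InPhase f N c t := fun v =>
  ⟨(h v).1, (h v).2.1, fun g hg => by
    obtain ⟨u, -, hu⟩ := ((h v).2.2 g).1 hg
    exact ⟨u, hu⟩, fun w hw => ((h v).2.2 _).2 ⟨w, hw, rfl⟩⟩

theorem InPhase.result_eq_none {t : ℕ} (h : InPhase f N c t) (hs : Several c) (v : G.V) :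
    result f (mem f G N t v) = none := by
  obtain ⟨-, h2, h3, h4⟩ := h v
  refine if_neg fun hcl => h3.not_closed hs h4 ?_
  rw [← h2]; exact hcl.2

theorem PhaseStart.result_eq_some {t : ℕ} (h : PhaseStart f N c t) (hN : G.BoundedBy N)
    (hs : ¬ Several c) (v : G.V) :
    result f (mem f G N t v) = some (f (G.code, v.1)) := by
  obtain ⟨h1, h2, -⟩ := mem_invariant (f := f) (N := N) t v
  obtain ⟨h3, h4, h5, -⟩ := h.inPhase v
  have hall : ∀ w, fact c w ∈ known f G N t v := by
    simp only [Several, not_exists, not_not] at hs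
    exact fun w => ((h v).2.2 _).2 ⟨w, hs _ _, rfl⟩
  have hcl := h5.closed hs v hall
  rw [← h4] at hcl
  rw [result, if_pos ⟨h3, hcl⟩, h1, h2]
  rw [show entries (mem f G N t v).2.2.2.2.2 N = G.code from h5.entries_eq hN hall]

theorem InPhase.succ {t : ℕ} (h : InPhase f N c t) (ht : t % phaseLength N ≠ 0) :
    InPhase f N c (t + 1) := by
  intro v
  obtain ⟨h1, h2, h3, h4⟩ := h v
  refine ⟨time_succ_ne_zero (Or.inl h1), (name_succ ht).trans h2, ?_⟩
  by_cases ha : AwakeAt f G N t v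
  · refine ⟨fun g hg => ?_, fun w hw => (mem_known_succ ht ha).2 (Or.inl (h4 w hw))⟩
    rcases (mem_known_succ ht ha).1 hg with hg | ⟨u, -, -, hg⟩
    · exact h3 g hg
    · exact (h u).2.2.1 g hg
  · rw [known, mem_succ_of_not_awake ha]
    exact ⟨h3, h4⟩

theorem known_mono_succ {t : ℕ} {v : G.V} {g : Fact} (ht : t % phaseLength N ≠ 0)
    (hg : g ∈ known f G N t v) : g ∈ known f G N (t + 1) v := by
  by_cases ha : AwakeAt f G N t v
  · exact (mem_known_succ ht ha).2 (Or.inl hg)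
  · rw [known, mem_succ_of_not_awake ha]; exact hg

theorem phaseStart_one : PhaseStart f N (fun v : G.V => v.1) 1 := by
  have hm : ∀ v : G.V, mem f G N 0 v = (N, v.1, G.input v, 0, 0, []) := fun v =>
    memory_codeMemory _
  have hawake : ∀ v : G.V, AwakeAt f G N 0 v := fun v =>
    awakeAt_iff.2 ⟨by rw [hm]; exact if_neg fun h => h.1 rfl, wakes_of_mod v (Nat.zero_mod _)⟩
  intro v
  have e := mem_succ_of_awake (hawake v)
  rw [next, time_eq_of_awake (hawake v), if_pos rfl, hm] at e
  have hn : ((algorithm f).received G ((algorithm f).run G N 0) v).map Prod.fst = G.nbrIds v := by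
    rw [Algorithm.received, InputGraph.nbrIds, List.map_map]
    have : (fun u => G.graph.Adj v u ∧ (algorithm f).Awake ((algorithm f).run G N 0 u)) =
        fun u => G.graph.Adj v u := funext fun u => propext (and_iff_left (hawake u))
    rw [this]; rfl
  rw [Nat.zero_add] at e
  refine ⟨by rw [e]; exact one_ne_zero, by rw [e], fun g => ?_⟩
  rw [known, e]
  simp only [hn, List.mem_singleton]
  constructor
  · rintro rfl; exact ⟨v, rfl, rfl⟩
  · rintro ⟨u, hu, rfl⟩
    obtain rfl : u = v := Subtype.ext hu
    rfl

end Run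

end Sleeping.Gather


namespace Sleeping.Gather

/-! ### One phase of the gathering algorithm -/

section Phase

variable {f : List Entry × ℕ → ℕ} {G : InputGraph} {N : ℕ} {c : G.V → ℕ}

theorem slot_add_lt {N s r : ℕ} (hs : s < 2 * middle N) (hr : r < slotLength N) :
    s * slotLength N + r < phaseLength N := by
  have : (s + 1) * slotLength N ≤ 2 * middle N * slotLength N := Nat.mul_le_mul_right _ hs
  rw [phaseLength]
  rw [Nat.succ_mul] at this
  omega

theorem time_mod {N j s r : ℕ} (hs : s < 2 * middle N) (hr : r < slotLength N) :
    (j * phaseLength N + s * slotLength N + r) % phaseLength N = s * slotLength N + r := by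
  rw [Nat.add_assoc, Nat.mul_comm j, Nat.mul_add_mod, Nat.mod_eq_of_lt (slot_add_lt hs hr)]

theorem slot_eq {N s r : ℕ} (hr : r < slotLength N) :
    (s * slotLength N + r) / slotLength N = s := by
  rw [Nat.mul_comm, Nat.mul_add_div (slotLength_pos N), Nat.div_eq_of_lt hr, Nat.add_zero]

theorem round_eq {N s r : ℕ} (hr : r < slotLength N) :
    (s * slotLength N + r) % slotLength N = r := by
  rw [Nat.mul_comm, Nat.mul_add_mod, Nat.mod_eq_of_lt hr]

theorem mod_ne_zero_of_lt {N j t : ℕ} (h1 : j * phaseLength N < t)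
    (h2 : t < j * phaseLength N + phaseLength N) : t % phaseLength N ≠ 0 := by
  obtain ⟨k, rfl⟩ := Nat.exists_eq_add_of_lt h1
  rw [Nat.add_assoc, Nat.mul_comm j, Nat.mul_add_mod, Nat.mod_eq_of_lt (by omega)]
  omega

/-- When the vertices of a cluster taking part in a slot are awake. -/
theorem awakeAt_slot_iff (hc : IsClustering c) (hs : Several c) (hN : G.BoundedBy N) {j s r : ℕ}
    (h1 : 1 ≤ s) (h2 : s < 2 * middle N) (hr : r < slotLength N)
    (h : InPhase f N c (j * phaseLength N + s * slotLength N + r)) (v : G.V) :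
    AwakeAt f G N (j * phaseLength N + s * slotLength N + r) v ↔
      SlotActive N (c v)
        (target (known f G N (j * phaseLength N + s * slotLength N + r) v) (c v))
        (target (known f G N (j * phaseLength N + s * slotLength N + r) v)
          (target (known f G N (j * phaseLength N + s * slotLength N + r) v) (c v))) s ∧
      RoundActive N (depth c v) r := by
  obtain ⟨m1, m2, -⟩ := mem_invariant (f := f) (N := N)
    (j * phaseLength N + s * slotLength N + r) v
  obtain ⟨-, hn, hsound, hown⟩ := h v
  rw [awakeAt_iff, and_iff_right (h.result_eq_none hs v), Wakes, m1, m2, hn, time_mod h2 hr,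
    slot_eq hr, round_eq hr]
  rw [show layer (mem f G N (j * phaseLength N + s * slotLength N + r) v).2.2.2.2.2 (c v) v.1 N =
    depth c v from hsound.layer_eq hc hN hown]
  have hne : s * slotLength N + r ≠ 0 := by
    have : 0 < s * slotLength N := Nat.mul_pos h1 (slotLength_pos N)
    omega
  rw [or_iff_right hne, and_iff_right (by omega : s ≠ 0)]
  rfl

/-- All members of cluster `d` know the fact `g` at the beginning of round `t`. -/
def ClusterKnows (f : List Entry × ℕ → ℕ) (N : ℕ) (c : G.V → ℕ) (d t : ℕ) (g : Fact) : Prop :=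
  ∀ v, c v = d → g ∈ known f G N t v

/-- Cluster `d` takes part in slot `s` of phase `j`. -/
def TakesPart (f : List Entry × ℕ → ℕ) (N : ℕ) (c : G.V → ℕ) (j s d : ℕ) : Prop :=
  ∀ v, c v = d → ∀ r < slotLength N, RoundActive N (depth c v) r →
    AwakeAt f G N (j * phaseLength N + s * slotLength N + r) v

variable {j : ℕ}

theorem known_mono {t t' : ℕ} (h1 : j * phaseLength N < t) (h2 : t ≤ t')
    (h3 : t' ≤ j * phaseLength N + phaseLength N) {v : G.V} {g : Fact}
    (hg : g ∈ known f G N t v) : g ∈ known f G N t' v := by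
  induction t', h2 using Nat.le_induction with
  | base => exact hg
  | succ t' h2 ih => exact known_mono_succ (mod_ne_zero_of_lt (by omega) h3) (ih (by omega))

/-- During a slot, everything known to all members of a cluster taking part reaches all members of
an adjacent cluster taking part: it crosses an edge in the first round, travels from layer to layer
to the root, and from the root to all layers. -/
theorem TakesPart.clusterKnows (hc : IsClustering c) (hN : G.BoundedBy N) {s d e : ℕ}
    (h1 : 1 ≤ s) (h2 : s < 2 * middle N) (hd : TakesPart f N c j s d) (he : TakesPart f N c j s e)
    (hadj : d = e ∨ ∃ a b, c a = d ∧ c b = e ∧ G.graph.Adj a b) {g : Fact}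
    (hg : ClusterKnows f N c e (j * phaseLength N + s * slotLength N) g) :
    ClusterKnows f N c d (j * phaseLength N + (s + 1) * slotLength N) g := by
  set b := j * phaseLength N + s * slotLength N with hb
  have hW : slotLength N = 2 * N + 4 := rfl
  have hmod : ∀ r < slotLength N, (b + r) % phaseLength N ≠ 0 := by
    intro r hr
    rw [hb, time_mod h2 hr]
    have : 0 < s * slotLength N := Nat.mul_pos h1 (slotLength_pos N)
    omega
  have hmono : ∀ {r r' : ℕ} {v : G.V}, r ≤ r' → r' ≤ slotLength N → g ∈ known f G N (b + r) v →
      g ∈ known f G N (b + r') v := by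
    intro r r' v hr hr' hv
    induction r', hr using Nat.le_induction with
    | base => exact hv
    | succ r' _ ih => exact known_mono_succ (hmod r' (by omega)) (ih (by omega))
  have hsend : ∀ {r : ℕ} {v w : G.V}, r < slotLength N → TakesPart f N c j s (c v) →
      TakesPart f N c j s (c w) → RoundActive N (depth c v) r → RoundActive N (depth c w) r →
      G.graph.Adj w v → g ∈ known f G N (b + r) v → g ∈ known f G N (b + (r + 1)) w := by
    intro r v w hr hv hw hrv hrw hvw hgv
    exact (mem_known_succ (hmod r hr) (hw w rfl r hr hrw)).2
      (Or.inr ⟨v, hvw, hv v rfl r hr hrv, hgv⟩)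
  intro v hv
  obtain ⟨a, hav, ha⟩ : ∃ a, c a = c v ∧ g ∈ known f G N (b + 1) a := by
    rcases hadj with rfl | ⟨a, x, h3, h4, h5⟩
    · exact ⟨v, rfl, hmono (r := 0) (by omega) (by omega) (hg v hv)⟩
    · refine ⟨a, h3.trans hv.symm, hsend (r := 0) (v := x) (by omega) (h4 ▸ he) (h3 ▸ hd)
        (Or.inl rfl) (Or.inl rfl) h5 (hg x h4)⟩
  have hup : ∀ i, ∀ x, c x = c v → depth c x = i → g ∈ known f G N (b + (N + 2 - i)) x →
      g ∈ known f G N (b + (N + 2)) (root c v) := by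
    intro i
    induction i with
    | zero =>
      intro x hx hi hgx
      rw [hc.eq_root_of_depth_eq_zero hi, root_congr hc hx] at hgx
      exact hgx
    | succ i ih =>
      intro x hx hi hgx
      obtain ⟨u, hu1, hu2, hu3⟩ := hc.exists_depth_eq hi
      have hlt := hc.depth_lt hN x
      refine ih u (hu2.trans hx) hu3 ?_
      have e : N + 2 - i = N + 2 - (i + 1) + 1 := by omega
      rw [e]
      refine hsend (by omega) (hx ▸ hv ▸ hd) (hu2 ▸ hx ▸ hv ▸ hd) ?_ ?_ hu1.symm hgx
      · unfold RoundActive; omega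
      · unfold RoundActive; omega
  have hroot : g ∈ known f G N (b + (N + 2)) (root c v) := by
    have hlt := hc.depth_lt hN a
    exact hup _ a hav rfl (hmono (by omega) (by omega) ha)
  have hdown : ∀ i, ∀ x, c x = c v → depth c x = i → g ∈ known f G N (b + (N + 2 + i + 1)) x := by
    intro i
    induction i with
    | zero =>
      intro x hx hi
      rw [hc.eq_root_of_depth_eq_zero hi, root_congr hc hx]
      exact hmono (by omega) (by omega) hroot
    | succ i ih =>
      intro x hx hi
      obtain ⟨u, hu1, hu2, hu3⟩ := hc.exists_depth_eq hi
      have hlt := hc.depth_lt hN x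
      refine hsend (by omega) (hu2 ▸ hx ▸ hv ▸ hd) (hx ▸ hv ▸ hd) ?_ ?_ hu1
        (ih u (hu2.trans hx) hu3)
      · unfold RoundActive; omega
      · unfold RoundActive; omega
  have hlt := hc.depth_lt hN v
  have := hmono (r' := slotLength N) (by omega) le_rfl (hdown _ v rfl rfl)
  rwa [hb, Nat.add_assoc, ← Nat.succ_mul] at this

/-- In the course of a phase the vertices learn all that is needed for merging their cluster: after
the first two slots the cluster knows its target and the target of its target, and at the end all
facts about the new cluster and its neighbours. -/
theorem covers_of_phaseStart (hc : IsClustering c) (hs : Several c) (hN : G.BoundedBy N)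
    (h0 : PhaseStart f N c (j * phaseLength N + 1)) :
    (∀ t, j * phaseLength N < t → t ≤ j * phaseLength N + phaseLength N → InPhase f N c t) ∧
    (∀ t, j * phaseLength N + 3 * slotLength N ≤ t → t ≤ j * phaseLength N + phaseLength N →
      ∀ v, target (known f G N t v) (c v) = trueTarget c (c v) ∧
        target (known f G N t v) (trueTarget c (c v)) = trueTarget c (trueTarget c (c v))) ∧
    ∀ v u, merged c N u = merged c N v →
      Covers c (known f G N (j * phaseLength N + phaseLength N) v) (c u) := by
  have hT := hs.isTargetMap hc hN
  have hin : ∀ t, j * phaseLength N < t → t ≤ j * phaseLength N + phaseLength N →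
      InPhase f N c t := by
    intro t h1
    induction t, h1 using Nat.le_induction with
    | base => exact fun _ => h0.inPhase
    | succ t h1 ih => exact fun h2 => (ih (by omega)).succ (mod_ne_zero_of_lt h1 h2)
  have hM : middle N = 2 * N + 4 := rfl
  have hW : slotLength N = 2 * N + 4 := rfl
  have hF : 2 * middle N * slotLength N = phaseLength N := rfl
  -- `T s` is the first round of slot `s`.
  set T : ℕ → ℕ := fun s => j * phaseLength N + s * slotLength N with hTdef
  have hTle : ∀ {s s'}, s ≤ s' → T s ≤ T s' := fun h =>
    Nat.add_le_add_left (Nat.mul_le_mul_right _ h) _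
  have hT0 : ∀ {s}, 1 ≤ s → j * phaseLength N < T s := fun h => by
    have := Nat.mul_pos h (slotLength_pos N)
    simp only [hTdef]; omega
  have hTend : T (2 * middle N) = j * phaseLength N + phaseLength N := by simp only [hTdef, hF]
  have hmono : ∀ {s s' : ℕ} {d : ℕ} {g : Fact}, 1 ≤ s → s ≤ s' → s' ≤ 2 * middle N →
      ClusterKnows f N c d (T s) g → ClusterKnows f N c d (T s') g := fun h1 h2 h3 hk v hv =>
    known_mono (hT0 h1) (hTle h2) (hTend ▸ hTle h3) (hk v hv)
  have hround : ∀ {s r : ℕ}, 1 ≤ s → s < 2 * middle N → r < slotLength N →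
      InPhase f N c (j * phaseLength N + s * slotLength N + r) := by
    intro s r h1 h2 hr
    have := slot_add_lt h2 hr
    have := hT0 h1
    simp only [hTdef] at this
    exact hin _ (by omega) (by omega)
  have hall : ∀ {s : ℕ}, 1 ≤ s → s < 2 * middle N → (s = 1 ∨ s = 2 ∨ s = middle N) → ∀ d,
      TakesPart f N c j s d := by
    intro s h1 h2 h3 d v _ r hr hact
    refine (awakeAt_slot_iff hc hs hN h1 h2 hr (hround h1 h2 hr) v).2 ⟨?_, hact⟩
    unfold SlotActive; omega
  -- After the first two slots every cluster knows all facts about the adjacent clusters and about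
  -- the vertices adjacent to these.
  have k1 : ∀ w, ClusterKnows f N c (c w) (T 1) (fact c w) := by
    intro w v hv
    refine known_mono (j := j) (t := j * phaseLength N + 1) (by omega) ?_
      (hTend ▸ hTle (by omega)) ?_
    · simp only [hTdef]; omega
    · exact ((h0 v).2.2 _).2 ⟨w, hv.symm, rfl⟩
  have k2 : ∀ d w, (d = c w ∨ ∃ a b, c a = d ∧ c b = c w ∧ G.graph.Adj a b) →
      ClusterKnows f N c d (T 2) (fact c w) := fun d w hdw =>
    (hall le_rfl (by omega) (by omega) d).clusterKnows hc hN le_rfl (by omega)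
      (hall le_rfl (by omega) (by omega) _) hdw (k1 w)
  have k3 : ∀ d e, (d = e ∨ ∃ a b, c a = d ∧ c b = e ∧ G.graph.Adj a b) → ∀ w,
      (e = c w ∨ ∃ a b, c a = e ∧ c b = c w ∧ G.graph.Adj a b) →
      ClusterKnows f N c d (T 3) (fact c w) := fun d e hde w hew =>
    (hall (by omega) (by omega) (by omega) d).clusterKnows hc hN (by omega) (by omega)
      (hall (by omega) (by omega) (by omega) e) hde (k2 e w hew)
  have hcov : ∀ t, T 3 ≤ t → t ≤ j * phaseLength N + phaseLength N → ∀ v e,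
      (c v = e ∨ ∃ a b, c a = c v ∧ c b = e ∧ G.graph.Adj a b) →
      Covers c (known f G N t v) e := by
    intro t h1 h2 v e he x hx
    refine ⟨?_, fun w hw => ?_⟩
    · exact known_mono (hT0 (by omega)) h1 h2 (k3 _ e he x (Or.inl hx.symm) v rfl)
    · exact known_mono (hT0 (by omega)) h1 h2
        (k3 _ e he w (Or.inr ⟨x, w, hx, rfl, hw⟩) v rfl)
  have htgt : ∀ t, T 3 ≤ t → t ≤ j * phaseLength N + phaseLength N → ∀ v,
      target (known f G N t v) (c v) = trueTarget c (c v) ∧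
        target (known f G N t v) (trueTarget c (c v)) = trueTarget c (trueTarget c (c v)) := by
    intro t h1 h2 v
    have hsound := (hin t ((hT0 (by omega)).trans_le h1) h2 v).2.2.1
    obtain ⟨a, b, h3, h4, h5⟩ := hs.exists_adj v
    exact ⟨hsound.target_eq (hcov t h1 h2 v _ (Or.inl rfl)),
      hsound.target_eq (hcov t h1 h2 v _ (Or.inr ⟨a, b, h3, h4, h5⟩))⟩
  refine ⟨hin, htgt, ?_⟩
  set p := trueTarget c with hp
  have hpart : ∀ {s d : ℕ}, 3 ≤ s → s < 2 * middle N →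
      (s = 3 + (d + p d) ∨ s = 3 + (p d + p (p d)) ∨ s + 3 + (d + p d) = 2 * middle N ∨
        s + 3 + (p d + p (p d)) = 2 * middle N) → TakesPart f N c j s d := by
    rintro s d h1 h2 h3 v rfl r hr hact
    refine (awakeAt_slot_iff hc hs hN (by omega) h2 hr (hround (by omega) h2 hr) v).2 ⟨?_, hact⟩
    have := slot_add_lt h2 hr
    obtain ⟨e1, e2⟩ := htgt (j * phaseLength N + s * slotLength N + r)
      ((hTle h1).trans (Nat.le_add_right _ _)) (by omega) v
    rw [e1, e2]
    unfold SlotActive; omega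
  have hadj : ∀ {d : ℕ}, d ∈ Set.range c → ∃ a b, c a = d ∧ c b = p d ∧ G.graph.Adj a b := by
    rintro _ ⟨v, rfl⟩; exact hs.exists_adj v
  -- Facts travel along the chain of targets up to the mutual pair.
  have hup : ∀ k d g, d ∈ Set.range c → 2 * N - (d + p d) < k →
      ClusterKnows f N c d (T (4 + (d + p d))) g →
      ∃ e ∈ Set.range c, p (p e) = e ∧ limitName p N e = limitName p N d ∧
        ClusterKnows f N c e (T (middle N + 1)) g ∧
        ClusterKnows f N c (p e) (T (middle N + 1)) g := by
    intro k
    induction k with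
    | zero => exact fun d g _ hk => absurd hk (Nat.not_lt_zero _)
    | succ k ih =>
      intro d g hd hk hg
      have hle := hT.sum_le hd
      obtain ⟨a, b, h1, h2, h3⟩ := hadj hd
      by_cases hm : p (p d) = d
      · have hg' := hmono (by omega) (by omega : 4 + (d + p d) ≤ middle N) (by omega) hg
        refine ⟨d, hd, hm, rfl, hmono (by omega) (Nat.le_succ _) (by omega) hg', ?_⟩
        exact (hall (by omega) (by omega) (by omega) _).clusterKnows hc hN (by omega) (by omega)
          (hall (by omega) (by omega) (by omega) d) (Or.inr ⟨b, a, h2, h1, h3.symm⟩) hg'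
      · have hlt := hT.lt_of_ne hd hm
        have hle' := hT.sum_le (hT.map d hd)
        have hg' := hmono (by omega) (by omega : 4 + (d + p d) ≤ 3 + (p d + p (p d))) (by omega) hg
        have hg'' := (hpart (d := p d) (by omega) (by omega) (Or.inl rfl)).clusterKnows hc hN
          (by omega) (by omega) (hpart (d := d) (by omega) (by omega) (Or.inr (Or.inl rfl)))
          (Or.inr ⟨b, a, h2, h1, h3.symm⟩) hg'
        obtain ⟨e, he1, he2, he3, he4⟩ := ih (p d) g (hT.map d hd) (by omega)
          (by rwa [show 4 + (p d + p (p d)) = 3 + (p d + p (p d)) + 1 by omega])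
        exact ⟨e, he1, he2, he3.trans (hT.limitName_target hd), he4⟩
  -- From there they travel to all clusters whose chains end in this pair.
  have hdown : ∀ e ∈ Set.range c, p (p e) = e → ∀ g, ClusterKnows f N c e (T (middle N + 1)) g →
      ClusterKnows f N c (p e) (T (middle N + 1)) g → ∀ k d, d ∈ Set.range c →
      limitName p N e = limitName p N d → 2 * N - (d + p d) < k →
      ClusterKnows f N c d (T (2 * middle N - 3 - (d + p d))) g := by
    intro e he hm g hg1 hg2 k
    induction k with
    | zero => exact fun d _ _ hk => absurd hk (Nat.not_lt_zero _)
    | succ k ih =>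
      intro d hd hlim hk
      have hle := hT.sum_le hd
      obtain ⟨a, b, h1, h2, h3⟩ := hadj hd
      by_cases hm' : p (p d) = d
      · have hde : d = e ∨ d = p e := by
          rw [limitName_of_mutual hm, limitName_of_mutual hm'] at hlim
          rcases max_choice e (p e) with h4 | h4 <;> rcases max_choice d (p d) with h5 | h5 <;>
            rw [h4, h5] at hlim
          · exact Or.inl hlim.symm
          · right; rw [hlim, hm']
          · exact Or.inr hlim.symm
          · left; rw [← hm, hlim, hm']
        rcases hde with rfl | rfl
        · exact hmono (by omega) (by omega) (by omega) hg1
        · exact hmono (by omega) (by omega) (by omega) hg2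
      · have hlt := hT.lt_of_ne hd hm'
        have hle' := hT.sum_le (hT.map d hd)
        have hg' := ih (p d) (hT.map d hd) (hlim.trans (hT.limitName_target hd).symm) (by omega)
        refine hmono (by omega) (by omega) (by omega)
          ((hpart (d := d) (s := 2 * middle N - 3 - (p d + p (p d))) (by omega) (by omega)
            (by omega)).clusterKnows hc hN (by omega) (by omega)
            (hpart (d := p d) (by omega) (by omega) (by omega)) (Or.inr ⟨a, b, h1, h2, h3⟩) hg')
  have hfin : ∀ v u, merged c N u = merged c N v → ∀ g, ClusterKnows f N c (c u) (T 3) g →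
      g ∈ known f G N (j * phaseLength N + phaseLength N) v := by
    intro v u huv g hg
    have hle := hT.sum_le (d := c u) ⟨u, rfl⟩
    obtain ⟨e, he1, he2, he3, he4, he5⟩ := hup (2 * N + 1) (c u) g ⟨u, rfl⟩ (by omega)
      (hmono (by omega) (by omega) (by omega) hg)
    have hd := hdown e he1 he2 g he4 he5 (2 * N + 1) (c v) ⟨v, rfl⟩ (he3.trans huv) (by omega)
    have hle' := hT.sum_le (d := c v) ⟨v, rfl⟩
    have := hmono (s' := 2 * middle N) (by omega) (by omega) le_rfl hd v rfl
    rwa [hTend] at this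
  intro v u huv x hx
  exact ⟨hfin v u huv _ (k3 _ _ (Or.inl rfl) x (Or.inl hx.symm)), fun w hw =>
    hfin v u huv _ (k3 _ _ (Or.inl rfl) w (Or.inr ⟨x, w, hx, rfl, hw⟩))⟩

theorem PhaseStart.merged (hc : IsClustering c) (hs : Several c) (hN : G.BoundedBy N)
    (h0 : PhaseStart f N c (j * phaseLength N + 1)) :
    PhaseStart f N (merged c N) ((j + 1) * phaseLength N + 1) := by
  obtain ⟨hin, -, hcov⟩ := covers_of_phaseStart hc hs hN h0
  have hpos := phaseLength_pos N
  have hin' := hin (j * phaseLength N + phaseLength N) (by omega) le_rfl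
  rw [← Nat.succ_mul] at hin' hcov
  have hmod : (j + 1) * phaseLength N % phaseLength N = 0 := Nat.mul_mod_left _ _
  have hne : (j + 1) * phaseLength N ≠ 0 := (Nat.mul_pos (Nat.succ_pos j) hpos).ne'
  intro v
  obtain ⟨h1, h2, h3, -⟩ := hin' v
  have ha : AwakeAt f G N ((j + 1) * phaseLength N) v :=
    awakeAt_iff.2 ⟨hin'.result_eq_none hs v, wakes_of_mod v hmod⟩
  obtain ⟨m1, -⟩ := mem_invariant (f := f) (N := N) ((j + 1) * phaseLength N) v
  have e := mem_succ_of_awake ha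
  rw [next, time_eq_of_awake ha, if_neg hne, m1, if_pos hmod, h2] at e
  refine ⟨by rw [e]; exact Nat.succ_ne_zero _, ?_, fun g => ?_⟩
  · rw [e]; exact h3.newName_eq hs hc hN (hcov v)
  · rw [known, e]; exact h3.mem_newFacts hs hc hN (hcov v)

end Phase

end Sleeping.Gather


namespace Sleeping.Gather

/-! ### The awake complexity of the gathering algorithm -/

section Phase

variable {f : List Entry × ℕ → ℕ} {G : InputGraph} {N : ℕ} {c : G.V → ℕ} {j : ℕ}

/-- The slots in which a cluster `d` with target `p` and `p'` the target of `p` may take part. -/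
def slots (N d p p' : ℕ) : Finset ℕ :=
  {1, 2, middle N, 3 + (d + p), 3 + (p + p'), 2 * middle N - 3 - (d + p),
    2 * middle N - 3 - (p + p')}

theorem card_slots_le (N d p p' : ℕ) : (slots N d p p').card ≤ 7 :=
  (Finset.card_insert_le _ _).trans (Nat.succ_le_succ Finset.card_le_six)

theorem mem_slots {N d p p' s : ℕ} (h : s < 3 ∨ SlotActive N d p p' s) (h1 : 1 ≤ s) :
    s ∈ slots N d p p' := by
  simp only [slots, Finset.mem_insert, Finset.mem_singleton]
  unfold SlotActive at h
  omega

/-- The rounds of a slot in which a vertex of depth `l` may be awake. -/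
def rounds (N l : ℕ) : Finset ℕ := {0, N + 2 - l, N + 2 - l - 1, N + 2 + l, N + 2 + l + 1}

theorem card_rounds_le (N l : ℕ) : (rounds N l).card ≤ 5 := Finset.card_le_five

theorem mem_rounds {N l r : ℕ} (h : RoundActive N l r) : r ∈ rounds N l := by
  simp only [rounds, Finset.mem_insert, Finset.mem_singleton]
  unfold RoundActive at h
  omega

attribute [local irreducible] slots rounds

/-- The rounds in which a vertex of cluster `d` and depth `l` may be awake in phase `j`. -/
noncomputable def candidates (c : G.V → ℕ) (N j d l : ℕ) : Finset ℕ :=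
  insert (j * phaseLength N) (Finset.image₂ (fun s r => j * phaseLength N + s * slotLength N + r)
    (slots N d (trueTarget c d) (trueTarget c (trueTarget c d))) (rounds N l))

theorem card_candidates_le (c : G.V → ℕ) (N j d l : ℕ) : (candidates c N j d l).card ≤ 36 :=
  (Finset.card_insert_le _ _).trans (Nat.succ_le_succ ((Finset.card_image₂_le _ _ _).trans
    (Nat.mul_le_mul (card_slots_le _ _ _ _) (card_rounds_le _ _))))

theorem mem_candidates (hc : IsClustering c) (hs : Several c) (hN : G.BoundedBy N)
    (h0 : PhaseStart f N c (j * phaseLength N + 1)) {t : ℕ} (h1 : j * phaseLength N ≤ t)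
    (h2 : t < (j + 1) * phaseLength N) {v : G.V} (ha : AwakeAt f G N t v) :
    t ∈ candidates c N j (c v) (depth c v) := by
  obtain ⟨hin, htgt, -⟩ := covers_of_phaseStart hc hs hN h0
  rw [Nat.succ_mul] at h2
  obtain ⟨q, rfl⟩ := Nat.exists_eq_add_of_le h1
  have hq : q < phaseLength N := by omega
  have hM : middle N = 2 * N + 4 := rfl
  obtain ⟨s, r, hr, rfl⟩ : ∃ s r, r < slotLength N ∧ q = s * slotLength N + r :=
    ⟨q / slotLength N, q % slotLength N, Nat.mod_lt _ (slotLength_pos N),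
      (Nat.div_add_mod' q _).symm⟩
  have hs2 : s < 2 * middle N := by
    by_contra hcon
    have := Nat.mul_le_mul_right (slotLength N) (not_lt.1 hcon)
    rw [show 2 * middle N * slotLength N = phaseLength N from rfl] at this
    omega
  rw [← Nat.add_assoc] at ha ⊢
  by_cases hz : s * slotLength N + r = 0
  · rw [Nat.add_assoc, hz, Nat.add_zero]; exact Finset.mem_insert_self _ _
  have hin' := hin (j * phaseLength N + s * slotLength N + r) (by omega) (by omega)
  have hs1 : 1 ≤ s := by
    rcases Nat.eq_zero_or_pos s with rfl | h
    · exfalso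
      obtain ⟨m1, -⟩ := mem_invariant (f := f) (N := N)
        (j * phaseLength N + 0 * slotLength N + r) v
      have hw := (awakeAt_iff.1 ha).2
      rw [Wakes, m1, time_mod hs2 hr, slot_eq hr] at hw
      omega
    · exact h
  obtain ⟨hact, hround⟩ := (awakeAt_slot_iff hc hs hN hs1 hs2 hr hin' v).1 ha
  refine Finset.mem_insert_of_mem (Finset.mem_image₂_of_mem ?_ (mem_rounds hround))
  by_cases h3 : s < 3
  · exact mem_slots (Or.inl h3) hs1
  · have hle := Nat.mul_le_mul_right (slotLength N) (not_lt.1 h3)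
    obtain ⟨e1, e2⟩ := htgt (j * phaseLength N + s * slotLength N + r) (by omega) (by omega) v
    rw [e1, e2] at hact
    exact mem_slots (Or.inr hact) hs1

attribute [irreducible] candidates

end Phase

section Complexity

variable {f : List Entry × ℕ → ℕ} {G : InputGraph} {N : ℕ}

/-- The clustering at the beginning of phase `j`. -/
noncomputable def clustering (G : InputGraph) (N : ℕ) : ℕ → G.V → ℕ
  | 0 => fun v => v.1
  | j + 1 => merged (clustering G N j) N

theorem phaseStart_clustering (hN : G.BoundedBy N) (j : ℕ)
    (h : ∀ i < j, Several (clustering G N i)) :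
    IsClustering (clustering G N j) ∧
      PhaseStart f N (clustering G N j) (j * phaseLength N + 1) ∧
      2 ^ j * (Finset.univ.image (clustering G N j)).card ≤ G.size := by
  induction j with
  | zero =>
    refine ⟨isClustering_id, by rw [Nat.zero_mul]; exact phaseStart_one, ?_⟩
    rw [pow_zero, one_mul]
    refine Finset.card_image_le.trans ?_
    simp [InputGraph.size]
  | succ j ih =>
    obtain ⟨h1, h2, h3⟩ := ih fun i hi => h i (by omega)
    have hs := h j (Nat.lt_succ_self j)
    refine ⟨hs.isClustering_merged h1 hN, h2.merged h1 hs hN, ?_⟩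
    refine le_trans ?_ h3
    rw [pow_succ, mul_assoc]
    exact Nat.mul_le_mul_left _ (hs.card_merged h1 hN)

/-- The number of clusters is at least halved in every phase until only one is left. -/
theorem exists_not_several (hN : G.BoundedBy N) :
    ∃ J, ¬ Several (clustering G N J) ∧ (∀ i < J, Several (clustering G N i)) ∧
      2 ^ J ≤ G.size := by
  classical
  have hv : Nonempty G.V := G.connected.nonempty
  have key : ∀ j, (∀ i < j, Several (clustering G N i)) → 2 ^ j ≤ G.size := by
    intro j hj
    obtain ⟨-, -, h3⟩ := phaseStart_clustering (f := fun _ => 0) hN j hj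
    have : 0 < (Finset.univ.image (clustering G N j)).card :=
      Finset.card_pos.2 (Finset.univ_nonempty.image _)
    nlinarith [Nat.pos_of_ne_zero (pow_ne_zero j (two_ne_zero : (2 : ℕ) ≠ 0))]
  have hex : ∃ J, ¬ Several (clustering G N J) := by
    by_contra hcon
    push Not at hcon
    have := key G.size fun i _ => hcon i
    exact absurd this (not_le.2 Nat.lt_two_pow_self)
  refine ⟨Nat.find hex, Nat.find_spec hex, fun i hi => not_not.1 (Nat.find_min hex hi), ?_⟩
  exact key _ fun i hi => not_not.1 (Nat.find_min hex hi)

/-- The algorithm terminates with the output of `f`, and every vertex is awake in at most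
`36 * J + 1` rounds if there are `J` phases. -/
theorem algorithm_outputs (f : List Entry × ℕ → ℕ) (hN : G.BoundedBy N) :
    (algorithm f).Outputs G N (fun v => f (G.code, v.1)) ∧
      ∃ J, 2 ^ J ≤ G.size ∧ (algorithm f).awakeComplexity G N ≤ 36 * J + 1 := by
  obtain ⟨J, h1, h2, h3⟩ := exists_not_several hN
  obtain ⟨-, hJ, -⟩ := phaseStart_clustering (f := f) hN J h2
  have hres := hJ.result_eq_some hN h1
  refine ⟨⟨_, hres⟩, J, h3, Finset.sup_le fun v _ => ?_⟩
  have hend : ∀ t, J * phaseLength N + 1 ≤ t →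
      mem f G N t v = mem f G N (J * phaseLength N + 1) v := by
    intro t ht
    induction t, ht using Nat.le_induction with
    | base => rfl
    | succ t _ ih =>
      rw [mem_succ_of_not_awake, ih]
      intro ha
      have := (awakeAt_iff.1 ha).1
      rw [ih, hres] at this
      cases this
  have hsub : ∀ t, AwakeAt f G N t v → t ∈ ((Finset.range J).biUnion fun j =>
      candidates (clustering G N j) N j (clustering G N j v) (depth (clustering G N j) v)) ∪
      {J * phaseLength N} := by
    intro t ht
    have hlt : t < J * phaseLength N + 1 := by
      by_contra hcon
      have := (awakeAt_iff.1 ht).1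
      rw [hend t (not_lt.1 hcon), hres] at this
      cases this
    rw [Finset.mem_union, Finset.mem_biUnion, Finset.mem_singleton]
    rcases Nat.lt_or_eq_of_le (Nat.lt_succ_iff.1 hlt) with hlt | rfl
    · left
      have hpos := phaseLength_pos N
      have hj : t / phaseLength N < J := (Nat.div_lt_iff_lt_mul hpos).2 hlt
      obtain ⟨hc, hst, -⟩ := phaseStart_clustering (f := f) hN (t / phaseLength N)
        fun i hi => h2 i (hi.trans hj)
      have h4 : t < (t / phaseLength N + 1) * phaseLength N := by
        rw [mul_comm]; exact Nat.lt_mul_div_succ t hpos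
      exact ⟨t / phaseLength N, Finset.mem_range.2 hj,
        mem_candidates hc (h2 _ hj) hN hst (Nat.div_mul_le_self t _) h4 ht⟩
    · right; rfl
  have hcard := Set.ncard_le_ncard (s := {t | AwakeAt f G N t v}) hsub (Finset.finite_toSet _)
  rw [Set.ncard_coe_finset] at hcard
  refine hcard.trans ((Finset.card_union_le _ _).trans (Nat.add_le_add ?_ (by simp)))
  refine Finset.card_biUnion_le.trans ?_
  refine (Finset.sum_le_card_nsmul _ _ 36 fun j _ => card_candidates_le _ _ _ _ _).trans ?_
  simp [mul_comm]

/-- A decidable problem is solved by collecting the input graph everywhere. -/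
theorem exists_algorithm {P : Problem} (hP : P.IsDecidable) :
    ∃ A : Algorithm, A.IsComputable ∧ A.UsesOnlyBound ∧ A.Solves P ∧
      ∀ (G : InputGraph) (N : ℕ), G.BoundedBy N → 2 ≤ G.size →
        (A.awakeComplexity G N : ℝ) ≤ 60 * Real.log G.size := by
  obtain ⟨f, hf, hsol⟩ := hP
  refine ⟨algorithm f, algorithm_isComputable hf, algorithm_usesOnlyBound f,
    fun n N G _ hN => ⟨_, (algorithm_outputs f hN).1, hsol G⟩, fun G N hN h2 => ?_⟩
  obtain ⟨-, J, hJ, hle⟩ := algorithm_outputs f hN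
  have hlog2 := Real.log_two_gt_d9
  have h1 : (J : ℝ) * Real.log 2 ≤ Real.log G.size := by
    rw [← Real.log_pow]
    exact Real.log_le_log (by positivity) (by exact_mod_cast hJ)
  have h3 : Real.log 2 ≤ Real.log G.size :=
    Real.log_le_log (by norm_num) (by exact_mod_cast h2)
  have h4 : ((algorithm f).awakeComplexity G N : ℝ) ≤ 36 * J + 1 := by exact_mod_cast hle
  have h5 : (J : ℝ) * 0.69 ≤ Real.log G.size := by
    refine le_trans (mul_le_mul_of_nonneg_left ?_ (Nat.cast_nonneg J)) h1
    linarith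
  linarith

end Complexity

end Sleeping.Gather


namespace Sleeping.Cycle

/-! ### Processes on labelled cycles -/

/-- The assignments of distinct identifiers from `{1, …, N}` to the positions of an `n`-cycle. -/
abbrev Labelling (n N : ℕ) : Type :=
  {f : ZMod n → ℕ // Function.Injective f ∧ ∀ x, 1 ≤ f x ∧ f x ≤ N}

/-- The labels around position `x` of `f` are those around position `y` of `g`. -/
structure SameView {n N : ℕ} (f g : Labelling n N) (x y : ZMod n) : Prop where
  self : f.1 x = g.1 y
  prev : f.1 (x - 1) = g.1 (y - 1)
  next : f.1 (x + 1) = g.1 (y + 1)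

/-- An execution on all labelled cycles, with those features of a sleeping algorithm that the lower
bound uses: the next status of a vertex is determined by the labels and statuses around it and, if
it is not awake, by the labels around it and its own status alone. -/
structure CycleProcess (n N : ℕ) where
  status : Labelling n N → ℕ → ZMod n → VertexStatus
  Awake : ℕ → VertexStatus → Prop
  status_zero : ∀ {f g x y}, SameView f g x y → status f 0 x = status g 0 y
  status_succ : ∀ {f g x y t}, SameView f g x y → status f t x = status g t y →
    status f t (x - 1) = status g t (y - 1) → status f t (x + 1) = status g t (y + 1) →
    status f (t + 1) x = status g (t + 1) y
  status_succ_of_not_awake : ∀ {f g x y t}, SameView f g x y → status f t x = status g t y →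
    ¬ Awake t (status f t x) → status f (t + 1) x = status g (t + 1) y

/-- The labels that follow position `p`, beginning with that of `p` itself, are `σ`. -/
def Contains {n N : ℕ} (σ : List ℕ) (f : Labelling n N) (p : ZMod n) : Prop :=
  ∀ (i : ℕ) (h : i < σ.length), f.1 (p + i) = σ[i]

section Contains

variable {n N : ℕ} {f g : Labelling n N} {p q : ZMod n} {σ τ : List ℕ}

theorem contains_append :
    Contains (σ ++ τ) f p ↔ Contains σ f p ∧ Contains τ f (p + σ.length) := by
  constructor
  · refine fun h => ⟨fun i hi => ?_, fun i hi => ?_⟩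
    · rw [h i (by simp; omega), List.getElem_append_left hi]
    · have := h (σ.length + i) (by simp; omega)
      rw [List.getElem_append_right (by omega)] at this
      simpa [add_assoc] using this
  · rintro ⟨h1, h2⟩ i hi
    rcases lt_or_ge i σ.length with h | h
    · rw [h1 i h, List.getElem_append_left h]
    · rw [List.getElem_append_right h, ← h2,
        add_assoc, ← Nat.cast_add, Nat.add_sub_cancel' h]

theorem Contains.sameView (hf : Contains σ f p) (hg : Contains σ g q) {o : ℕ} (h1 : 1 ≤ o)
    (h2 : o + 1 < σ.length) : SameView f g (p + o) (q + o) := by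
  obtain ⟨o, rfl⟩ := Nat.exists_eq_add_of_le' h1
  refine ⟨?_, ?_, ?_⟩
  · rw [hf _ (by omega), hg _ (by omega)]
  · have e (p : ZMod n) : p + ((o + 1 : ℕ) : ZMod n) - 1 = p + (o : ℕ) := by push_cast; ring
    rw [e, e, hf _ (by omega), hg _ (by omega)]
  · have e (p : ZMod n) : p + ((o + 1 : ℕ) : ZMod n) + 1 = p + ((o + 2 : ℕ) : ZMod n) := by
      push_cast; ring
    rw [e, e, hf _ (by omega), hg _ (by omega)]

end Contains

namespace CycleProcess

variable {n N : ℕ} (Y : CycleProcess n N)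

/-- Up to time `T`, the status of the vertex at offset `o` in a segment of the cycle with labels
`σ` depends on nothing else in the cycle. -/
def Agree (σ : List ℕ) (o T : ℕ) : Prop :=
  ∀ (f g : Labelling n N) (p q : ZMod n), Contains σ f p → Contains σ g q →
    ∀ t ≤ T, Y.status f t (p + o) = Y.status g t (q + o)

/-- The status of the vertex at offset `o` in a segment with labels `σ` depends on nothing else in
the cycle, either for ever or until a time at which the vertex is awake after having been awake at
least `a` times. -/
def Determined (σ : List ℕ) (o a : ℕ) : Prop :=
  (∀ T, Y.Agree σ o T) ∨ ∃ T, Y.Agree σ o T ∧ ∀ (f : Labelling n N) (p : ZMod n), Contains σ f p →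
    Y.Awake T (Y.status f T (p + o)) ∧
      ∃ s : Finset ℕ, s.card = a ∧ ∀ t ∈ s, t < T ∧ Y.Awake t (Y.status f t (p + o))

variable {Y} {σ τ ρ : List ℕ} {o a T T' : ℕ}

theorem Agree.mono (h : Y.Agree σ o T) (hT : T' ≤ T) : Y.Agree σ o T' :=
  fun f g p q hf hg t ht => h f g p q hf hg t (ht.trans hT)

theorem Agree.extend (h : Y.Agree σ o T) (τ ρ : List ℕ) :
    Y.Agree (τ ++ σ ++ ρ) (τ.length + o) T := by
  intro f g p q hf hg t ht
  have := h f g _ _ (contains_append.1 (contains_append.1 hf).1).2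
    (contains_append.1 (contains_append.1 hg).1).2 t ht
  rwa [add_assoc, add_assoc, ← Nat.cast_add] at this

theorem agree_zero (h1 : 1 ≤ o) (h2 : o + 1 < σ.length) : Y.Agree σ o 0 := by
  intro f g p q hf hg t ht
  obtain rfl : t = 0 := by omega
  exact Y.status_zero (hf.sameView hg h1 h2)

theorem Agree.succ (h1 : 1 ≤ o) (h2 : o + 1 < σ.length) (h : Y.Agree σ o T)
    (hp : Y.Agree σ (o - 1) T) (hn : Y.Agree σ (o + 1) T) : Y.Agree σ o (T + 1) := by
  intro f g p q hf hg t ht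
  rcases Nat.lt_or_eq_of_le ht with ht | rfl
  · exact h f g p q hf hg t (by omega)
  · have := hp f g p q hf hg T le_rfl
    have e (p : ZMod n) : p + ((o - 1 : ℕ) : ZMod n) = p + o - 1 := by
      rw [Nat.cast_sub h1]; push_cast; ring
    refine Y.status_succ (hf.sameView hg h1 h2) (h f g p q hf hg T le_rfl) ?_ ?_
    · rwa [e, e] at this
    · have := hn f g p q hf hg T le_rfl
      rwa [Nat.cast_succ, ← add_assoc, ← add_assoc] at this

/-- Two vertices whose statuses are determined by the segment shield the vertices between them from
the rest of the cycle. -/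
theorem Agree.between {lo hi : ℕ} (h1 : 1 ≤ lo) (h2 : hi + 1 < σ.length) (hlo : Y.Agree σ lo T)
    (hhi : Y.Agree σ hi T) (ho : lo ≤ o) (ho' : o ≤ hi) : Y.Agree σ o T := by
  induction T generalizing o with
  | zero => exact agree_zero (by omega) (by omega)
  | succ T ih =>
    have ih' := fun o => @ih o (hlo.mono T.le_succ) (hhi.mono T.le_succ)
    rcases Nat.eq_or_lt_of_le ho with rfl | ho
    · exact hlo
    rcases Nat.eq_or_lt_of_le ho' with rfl | ho'
    · exact hhi
    exact (ih' o (by omega) (by omega)).succ (by omega) (by omega)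
      (ih' (o - 1) (by omega) (by omega)) (ih' (o + 1) (by omega) (by omega))

/-- As long as a vertex is not awake, its status remains determined by the segment. -/
theorem Agree.forever_or_awake (h1 : 1 ≤ o) (h2 : o + 1 < σ.length) (h : Y.Agree σ o T) :
    (∀ T', Y.Agree σ o T') ∨ ∃ T', T ≤ T' ∧ Y.Agree σ o T' ∧
      ∀ (f : Labelling n N) (p : ZMod n), Contains σ f p → Y.Awake T' (Y.status f T' (p + o)) := by
  rw [or_iff_not_imp_right]
  intro hno
  have key : ∀ d, Y.Agree σ o (T + d) := by
    intro d
    induction d with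
    | zero => exact h
    | succ d ih =>
      have : ∃ (f : Labelling n N) (p : ZMod n), Contains σ f p ∧
          ¬ Y.Awake (T + d) (Y.status f (T + d) (p + o)) := by
        by_contra hcon
        push Not at hcon
        exact hno ⟨T + d, by omega, ih, hcon⟩
      obtain ⟨f₀, p₀, hf₀, hsleep⟩ := this
      intro f g p q hf hg t ht
      rcases Nat.lt_or_eq_of_le ht with ht | rfl
      · exact ih f g p q hf hg t (by omega)
      · refine Y.status_succ_of_not_awake (t := T + d) (hf.sameView hg h1 h2)
          (ih f g p q hf hg _ le_rfl) ?_
        rwa [ih f f₀ p p₀ hf hf₀ _ le_rfl]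
  intro T'
  exact (key T').mono (by omega)

theorem determined_zero (h : σ.length = 3) : Y.Determined σ 1 0 := by
  rcases (agree_zero (Y := Y) (σ := σ) (o := 1) le_rfl (by omega)).forever_or_awake le_rfl
    (by omega) with h | ⟨T, -, hT, hawake⟩
  · exact Or.inl h
  · exact Or.inr ⟨T, hT, fun f p hf => ⟨hawake f p hf, ∅, by simp⟩⟩

/-- If the middle one of three determined vertices is awake no later than the outer ones, then all
that it can learn in that round is determined by the segments. -/
theorem Determined.succ_of_le {σ₁ σ₂ σ₃ : List ℕ} {o₁ o₂ o₃ T₁ T₂ T₃ : ℕ}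
    (h₁ : 1 ≤ o₁ ∧ o₁ + 1 < σ₁.length) (h₂ : 1 ≤ o₂ ∧ o₂ + 1 < σ₂.length)
    (h₃ : 1 ≤ o₃ ∧ o₃ + 1 < σ₃.length)
    (hA₁ : Y.Agree σ₁ o₁ T₁) (hA₂ : Y.Agree σ₂ o₂ T₂) (hA₃ : Y.Agree σ₃ o₃ T₃)
    (hawake : ∀ (f : Labelling n N) (p : ZMod n), Contains σ₂ f p →
      Y.Awake T₂ (Y.status f T₂ (p + o₂)) ∧
        ∃ s : Finset ℕ, s.card = a ∧ ∀ t ∈ s, t < T₂ ∧ Y.Awake t (Y.status f t (p + o₂)))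
    (h12 : T₂ ≤ T₁) (h32 : T₂ ≤ T₃) :
    Y.Determined (σ₁ ++ σ₂ ++ σ₃) (σ₁.length + o₂) (a + 1) := by
  have hlo : Y.Agree (σ₁ ++ σ₂ ++ σ₃) o₁ T₂ := by
    simpa using (hA₁.mono h12).extend [] (σ₂ ++ σ₃)
  have hhi : Y.Agree (σ₁ ++ σ₂ ++ σ₃) (σ₁.length + σ₂.length + o₃) T₂ := by
    simpa using (hA₃.mono h32).extend (σ₁ ++ σ₂) []
  have hlen : (σ₁ ++ σ₂ ++ σ₃).length = σ₁.length + σ₂.length + σ₃.length := by simp; omega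
  have hall : ∀ o, o₁ ≤ o → o ≤ σ₁.length + σ₂.length + o₃ → Y.Agree (σ₁ ++ σ₂ ++ σ₃) o T₂ :=
    fun o => hlo.between h₁.1 (by omega) hhi
  have hnext := (hall (σ₁.length + o₂) (by omega) (by omega)).succ (by omega) (by omega)
    (hall _ (by omega) (by omega)) (hall _ (by omega) (by omega))
  rcases hnext.forever_or_awake (by omega) (by omega) with h | ⟨T, hT, hA, hawake'⟩
  · exact Or.inl h
  refine Or.inr ⟨T, hA, fun f p hf => ⟨hawake' f p hf, ?_⟩⟩
  obtain ⟨hw, s, hs, hst⟩ := hawake f _ (contains_append.1 (contains_append.1 hf).1).2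
  rw [add_assoc, ← Nat.cast_add] at hw
  refine ⟨insert T₂ s, ?_, ?_⟩
  · rw [Finset.card_insert_of_notMem fun h => (hst _ h).1.false, hs]
  · intro t ht
    rcases Finset.mem_insert.1 ht with rfl | ht
    · exact ⟨by omega, hw⟩
    · obtain ⟨h, h'⟩ := hst t ht
      rw [add_assoc, ← Nat.cast_add] at h'
      exact ⟨by omega, h'⟩

theorem forever_extend (h : ∀ T, Y.Agree σ o T) (τ ρ : List ℕ) :
    Y.Determined (τ ++ σ ++ ρ) (τ.length + o) a :=
  Or.inl fun T => (h T).extend τ ρ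

/-- Any `3 ^ (a + 1)` labels can be arranged such that an inner vertex is awake at least `a` times
before it can learn anything about the rest of the cycle. -/
theorem exists_determined (a : ℕ) (l : List ℕ) (hl : l.length = 3 ^ (a + 1)) :
    ∃ (σ : List ℕ) (o : ℕ), σ.Perm l ∧ 1 ≤ o ∧ o + 1 < σ.length ∧ Y.Determined σ o a := by
  induction a generalizing l with
  | zero => exact ⟨l, 1, .refl l, le_rfl, by omega, determined_zero (by omega)⟩
  | succ a ih =>
    have hpow : 3 ^ (a + 1 + 1) = 3 * 3 ^ (a + 1) := by ring
    obtain ⟨l₁, l₂, l₃, rfl, e₁, e₂, e₃⟩ : ∃ l₁ l₂ l₃ : List ℕ, l = l₁ ++ l₂ ++ l₃ ∧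
        l₁.length = 3 ^ (a + 1) ∧ l₂.length = 3 ^ (a + 1) ∧ l₃.length = 3 ^ (a + 1) := by
      refine ⟨l.take (3 ^ (a + 1)), (l.drop (3 ^ (a + 1))).take (3 ^ (a + 1)),
        (l.drop (3 ^ (a + 1))).drop (3 ^ (a + 1)), ?_, ?_, ?_, ?_⟩
      · rw [List.append_assoc, List.take_append_drop, List.take_append_drop]
      all_goals simp; omega
    obtain ⟨σ₁, o₁, p₁, h₁, h₁', D₁⟩ := ih l₁ e₁
    obtain ⟨σ₂, o₂, p₂, h₂, h₂', D₂⟩ := ih l₂ e₂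
    obtain ⟨σ₃, o₃, p₃, h₃, h₃', D₃⟩ := ih l₃ e₃
    have finish : ∀ {τ₁ τ₂ τ₃ : List ℕ} {o : ℕ}, (τ₁ ++ τ₂ ++ τ₃).Perm (σ₁ ++ σ₂ ++ σ₃) → 1 ≤ o →
        o + 1 < τ₂.length → Y.Determined (τ₁ ++ τ₂ ++ τ₃) (τ₁.length + o) (a + 1) →
        ∃ (σ : List ℕ) (o : ℕ), σ.Perm (l₁ ++ l₂ ++ l₃) ∧ 1 ≤ o ∧ o + 1 < σ.length ∧
          Y.Determined σ o (a + 1) := fun {τ₁ τ₂ τ₃ o} hp ho ho' hD =>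
      ⟨_, _, hp.trans ((p₁.append p₂).append p₃), by omega, by simp; omega, hD⟩
    have perm₁ : (σ₂ ++ σ₁ ++ σ₃).Perm (σ₁ ++ σ₂ ++ σ₃) := List.perm_append_comm.append_right _
    have perm₃ : (σ₁ ++ σ₃ ++ σ₂).Perm (σ₁ ++ σ₂ ++ σ₃) := by
      rw [List.append_assoc, List.append_assoc]
      exact List.perm_append_comm.append_left _
    rcases D₁ with D₁ | ⟨T₁, A₁, w₁⟩
    · exact finish perm₁ h₁ h₁' (forever_extend D₁ _ _)
    rcases D₂ with D₂ | ⟨T₂, A₂, w₂⟩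
    · exact finish (.refl _) h₂ h₂' (forever_extend D₂ _ _)
    rcases D₃ with D₃ | ⟨T₃, A₃, w₃⟩
    · exact finish perm₃ h₃ h₃' (forever_extend D₃ _ _)
    -- The segment whose vertex is awake first is placed in the middle.
    by_cases c₁ : T₁ ≤ T₂ ∧ T₁ ≤ T₃
    · exact finish perm₁ h₁ h₁' (Determined.succ_of_le ⟨h₂, h₂'⟩ ⟨h₁, h₁'⟩ ⟨h₃, h₃'⟩
        A₂ A₁ A₃ w₁ c₁.1 c₁.2)
    by_cases c₂ : T₂ ≤ T₁ ∧ T₂ ≤ T₃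
    · exact finish (.refl _) h₂ h₂' (Determined.succ_of_le ⟨h₁, h₁'⟩ ⟨h₂, h₂'⟩ ⟨h₃, h₃'⟩
        A₁ A₂ A₃ w₂ c₂.1 c₂.2)
    · exact finish perm₃ h₃ h₃' (Determined.succ_of_le ⟨h₁, h₁'⟩ ⟨h₃, h₃'⟩ ⟨h₂, h₂'⟩
        A₁ A₃ A₂ w₃ (by omega) (by omega))

/-- With at most `k` awake rounds per vertex, any `3 ^ (k + 2)` labels can be arranged such that an
inner vertex never learns anything about the rest of the cycle. -/
theorem exists_agree {k : ℕ} (hk : ∀ (f : Labelling n N) (x : ZMod n) (s : Finset ℕ),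
    (∀ t ∈ s, Y.Awake t (Y.status f t x)) → s.card ≤ k) (l : List ℕ)
    (hl : l.length = 3 ^ (k + 2)) :
    ∃ (σ : List ℕ) (o : ℕ), σ.Perm l ∧ 1 ≤ o ∧ o + 1 < σ.length ∧ ∀ T, Y.Agree σ o T := by
  obtain ⟨σ, o, hp, h1, h2, D⟩ := exists_determined (Y := Y) (k + 1) l hl
  refine ⟨σ, o, hp, h1, h2, ?_⟩
  rcases D with D | ⟨T, -, hw⟩
  · exact D
  · intro T' f g p q hf
    obtain ⟨-, s, hs, hst⟩ := hw f p hf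
    have := hk f _ s fun t ht => (hst t ht).2
    omega

end CycleProcess

end Sleeping.Cycle


namespace Sleeping.Cycle

/-! ### Two leaders on a cycle -/

section List

variable {n N : ℕ} [NeZero n] {l : List ℕ}

/-- The labelling of a cycle by the entries of a list. -/
theorem exists_contains (hl : l.length = n) (hd : l.Nodup) (hb : ∀ i ∈ l, 1 ≤ i ∧ i ≤ N) :
    ∃ f : Labelling n N, Contains l f 0 := by
  refine ⟨⟨fun x => l[x.val]'(by rw [hl]; exact ZMod.val_lt x), fun x y h => ?_, fun x => ?_⟩, ?_⟩
  · exact ZMod.val_injective n ((hd.getElem_inj_iff).1 h)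
  · exact hb _ (List.getElem_mem _)
  · intro i hi
    simp only [zero_add]
    congr 1
    exact ZMod.val_cast_of_lt (hl ▸ hi)

end List

namespace CycleProcess

variable {n N : ℕ} {Y : CycleProcess n N}

/-- The vertices between two vertices whose statuses are determined for ever share this
property. -/
theorem agree_arc {σ τ : List ℕ} {o o' : ℕ} (h1 : 1 ≤ o) (h2 : o' + 1 < τ.length)
    (hσ : ∀ T, Y.Agree σ o T) (hτ : ∀ T, Y.Agree τ o' T) (F : List ℕ) (i : ℕ) (hi : o ≤ i)
    (hi' : i ≤ σ.length + F.length + o') (T : ℕ) : Y.Agree (σ ++ F ++ τ) i T := by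
  have hlo : Y.Agree (σ ++ F ++ τ) o T := by simpa using (hσ T).extend [] (F ++ τ)
  have hhi : Y.Agree (σ ++ F ++ τ) (σ.length + F.length + o') T := by
    simpa using (hτ T).extend (σ ++ F) []
  exact hlo.between h1 (by simp; omega) hhi hi hi'

/-- Among any `n` identifiers there is an arrangement of at most `n / 2` of them that forces a
vertex of the segment to become a leader, whatever the rest of the cycle is. -/
theorem exists_forced_leader {k : ℕ} [NeZero n] (hk : ∀ (f : Labelling n N) (x : ZMod n)
      (s : Finset ℕ), (∀ t ∈ s, Y.Awake t (Y.status f t x)) → s.card ≤ k)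
    {Lead : Labelling n N → ZMod n → Prop} (hex : ∀ f, ∃ x, Lead f x)
    (hcongr : ∀ f g x y, (∀ t, Y.status f t x = Y.status g t y) → Lead f x → Lead g y)
    (hn : 6 * 3 ^ (k + 2) + 12 ≤ n) (l : List ℕ) (hl : l.length = n) (hd : l.Nodup)
    (hb : ∀ i ∈ l, 1 ≤ i ∧ i ≤ N) :
    ∃ (τ : List ℕ) (o : ℕ), τ.Subperm l ∧ 2 * τ.length ≤ n ∧ o < τ.length ∧
      ∀ (g : Labelling n N) (q : ZMod n), Contains τ g q → Lead g (q + o) := by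
  set m := 3 ^ (k + 2) with hm
  obtain ⟨q, hq⟩ : ∃ q, q = n / 3 := ⟨_, rfl⟩
  have hq1 : 3 * q ≤ n := by omega
  have hq2 : n ≤ 3 * q + 2 := by omega
  -- The list is cut into three parts of about the same length; each begins with `m` labels to be
  -- rearranged.
  obtain ⟨l₁, F₁, l₂, F₂, l₃, F₃, rfl, a₁, b₁, a₂, b₂, a₃, b₃⟩ :
      ∃ l₁ F₁ l₂ F₂ l₃ F₃ : List ℕ, l = l₁ ++ (F₁ ++ (l₂ ++ (F₂ ++ (l₃ ++ F₃)))) ∧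
        l₁.length = m ∧ F₁.length = q - m ∧ l₂.length = m ∧ F₂.length = q - m ∧ l₃.length = m ∧
        F₃.length = n - 2 * q - m := by
    have split : ∀ (l : List ℕ) (a : ℕ), a ≤ l.length →
        ∃ l' r, l = l' ++ r ∧ l'.length = a ∧ r.length = l.length - a := fun l a ha =>
      ⟨l.take a, l.drop a, (List.take_append_drop a l).symm, by simp [ha], by simp⟩
    obtain ⟨l₁, r, rfl, a₁, c⟩ := split l m (by omega)
    obtain ⟨F₁, r, rfl, b₁, c⟩ := split r (q - m) (by omega)
    obtain ⟨l₂, r, rfl, a₂, c⟩ := split r m (by omega)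
    obtain ⟨F₂, r, rfl, b₂, c⟩ := split r (q - m) (by omega)
    obtain ⟨l₃, F₃, rfl, a₃, c⟩ := split r m (by omega)
    exact ⟨l₁, F₁, l₂, F₂, l₃, F₃, rfl, a₁, b₁, a₂, b₂, a₃, by omega⟩
  obtain ⟨σ₁, o₁, p₁, u₁, v₁, A₁⟩ := exists_agree hk l₁ a₁
  obtain ⟨σ₂, o₂, p₂, u₂, v₂, A₂⟩ := exists_agree hk l₂ a₂
  obtain ⟨σ₃, o₃, p₃, u₃, v₃, A₃⟩ := exists_agree hk l₃ a₃
  rw [← p₁.length_eq] at a₁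
  rw [← p₂.length_eq] at a₂
  rw [← p₃.length_eq] at a₃
  have hp : (σ₁ ++ (F₁ ++ (σ₂ ++ (F₂ ++ (σ₃ ++ F₃))))).Perm
      (l₁ ++ (F₁ ++ (l₂ ++ (F₂ ++ (l₃ ++ F₃))))) :=
    p₁.append ((p₂.append ((p₃.append_right _).append_left _)).append_left _)
  obtain ⟨f, hf⟩ := exists_contains (hp.length_eq.trans hl) (hp.nodup_iff.2 hd)
    fun i hi => hb i (hp.mem_iff.1 hi)
  simp only [contains_append, ← Nat.cast_add, add_assoc, zero_add, a₁, b₁, a₂, b₂, a₃] at hf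
  rw [show m + (q - m + m) = q + m by omega, show m + (q - m) = q by omega,
    show m + (q - m + q) = 2 * q by omega, show m + (q - m + (q + m)) = 2 * q + m by omega] at hf
  obtain ⟨hσ₁, hF₁, hσ₂, hF₂, hσ₃, hF₃⟩ := hf
  obtain ⟨x, hx⟩ := hex f
  have finish : ∀ (σ F τ : List ℕ) (o o' p i : ℕ), 1 ≤ o → o' + 1 < τ.length →
      (∀ T, Y.Agree σ o T) → (∀ T, Y.Agree τ o' T) → o ≤ i → i ≤ σ.length + F.length + o' →
      Contains (σ ++ F ++ τ) f p → x = (p : ZMod n) + i →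
      (σ ++ F ++ τ).Subperm (σ₁ ++ (F₁ ++ (σ₂ ++ (F₂ ++ (σ₃ ++ F₃))))) →
      2 * (σ ++ F ++ τ).length ≤ n →
      ∃ (τ : List ℕ) (o : ℕ), τ.Subperm (l₁ ++ (F₁ ++ (l₂ ++ (F₂ ++ (l₃ ++ F₃))))) ∧
        2 * τ.length ≤ n ∧ o < τ.length ∧
        ∀ (g : Labelling n N) (q : ZMod n), Contains τ g q → Lead g (q + o) := by
    intro σ F τ o o' p i h1 h2 hσ hτ hi hi' hc hxi hs hlen
    refine ⟨_, i, hs.trans hp.subperm, hlen, by simp; omega, fun g q hg => ?_⟩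
    refine hcongr f g x _ (fun t => ?_) hx
    rw [hxi]
    exact agree_arc h1 h2 hσ hτ F i hi hi' t f g _ _ hc hg t le_rfl
  have hxv : x = ((x.val : ℕ) : ZMod n) := (ZMod.natCast_zmod_val x).symm
  have hlt := ZMod.val_lt x
  generalize x.val = v at hxv hlt
  -- The determined vertices at `o₁`, `q + o₂` and `2 * q + o₃` divide the cycle into three arcs;
  -- the leader lies in one of them.
  by_cases c₁ : o₁ ≤ v ∧ v ≤ q + o₂
  · refine finish σ₁ F₁ σ₂ o₁ o₂ 0 v u₁ v₂ A₁ A₂ c₁.1 (by omega) ?_ (by simpa using hxv) ?_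
      (by simp; omega)
    · simp only [contains_append, Nat.cast_zero, zero_add, List.length_append, a₁, b₁]
      rw [show m + (q - m) = q by omega]
      exact ⟨⟨hσ₁, hF₁⟩, hσ₂⟩
    · refine List.Sublist.subperm ?_
      rw [List.append_assoc]
      exact ((List.sublist_append_left _ _).append_left _).append_left _
  by_cases c₂ : q + o₂ ≤ v ∧ v ≤ 2 * q + o₃
  · refine finish σ₂ F₂ σ₃ o₂ o₃ q (v - q) u₂ v₃ A₂ A₃ (by omega) (by omega) ?_ ?_ ?_
      (by simp; omega)
    · simp only [contains_append, ← Nat.cast_add, List.length_append, a₂, b₂]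
      rw [show q + (m + (q - m)) = 2 * q by omega]
      exact ⟨⟨hσ₂, hF₂⟩, hσ₃⟩
    · rw [hxv, ← Nat.cast_add]; congr 1; omega
    · refine (List.Sublist.subperm ?_)
      rw [List.append_assoc]
      refine List.Sublist.trans ?_ (List.sublist_append_right σ₁ _)
      refine List.Sublist.trans ?_ (List.sublist_append_right F₁ _)
      exact ((List.sublist_append_left _ _).append_left _).append_left _
  have hwrap : Contains (σ₃ ++ F₃ ++ σ₁) f ((2 * q : ℕ) : ZMod n) := by
    simp only [contains_append, ← Nat.cast_add, List.length_append, a₃, b₃]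
    rw [show 2 * q + (m + (n - 2 * q - m)) = n by omega, ZMod.natCast_self]
    exact ⟨⟨hσ₃, hF₃⟩, hσ₁⟩
  have hsub : (σ₃ ++ F₃ ++ σ₁).Subperm (σ₁ ++ (F₁ ++ (σ₂ ++ (F₂ ++ (σ₃ ++ F₃))))) := by
    refine List.perm_append_comm.subperm.trans (List.Sublist.subperm ?_)
    refine List.Sublist.append_left ?_ _
    rw [← List.append_assoc, ← List.append_assoc]
    exact List.sublist_append_right _ _
  rcases lt_or_ge v o₁ with c₃ | c₃
  · refine finish σ₃ F₃ σ₁ o₃ o₁ (2 * q) (n - 2 * q + v) u₃ v₁ A₃ A₁ (by omega) (by omega) hwrap ?_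
      hsub (by simp; omega)
    rw [hxv, ← Nat.cast_add, show 2 * q + (n - 2 * q + v) = n + v by omega, Nat.cast_add,
      ZMod.natCast_self, zero_add]
  · refine finish σ₃ F₃ σ₁ o₃ o₁ (2 * q) (v - 2 * q) u₃ v₁ A₃ A₁ (by omega) (by omega) hwrap ?_
      hsub (by simp; omega)
    rw [hxv, ← Nat.cast_add]; congr 1; omega

/-- There is no process with a single leader in which vertices are awake rarely: two segments that
force a leader, with disjoint sets of labels, fit into one cycle. -/
theorem not_existsUnique_leader {k : ℕ} [NeZero n] (hk : ∀ (f : Labelling n N) (x : ZMod n)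
      (s : Finset ℕ), (∀ t ∈ s, Y.Awake t (Y.status f t x)) → s.card ≤ k)
    {Lead : Labelling n N → ZMod n → Prop} (hex : ∀ f, ∃! x, Lead f x)
    (hcongr : ∀ f g x y, (∀ t, Y.status f t x = Y.status g t y) → Lead f x → Lead g y)
    (hn : 6 * 3 ^ (k + 2) + 12 ≤ n) (hN : 3 * n ≤ N) : False := by
  have nodup : ∀ {τ l : List ℕ}, τ.Subperm l → l.Nodup → τ.Nodup :=
    fun ⟨_, hp, hs⟩ hl => hp.nodup_iff.1 (hl.sublist hs)
  obtain ⟨τ, o, hs, hlen, ho, hlead⟩ := exists_forced_leader hk (fun f => (hex f).exists) hcongr hn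
    (List.range' 1 n) (by simp) List.nodup_range' (by simp; omega)
  obtain ⟨τ', o', hs', hlen', ho', hlead'⟩ := exists_forced_leader hk (fun f => (hex f).exists)
    hcongr hn (List.range' (n + 1) n) (by simp) List.nodup_range' (by simp; omega)
  set ρ := List.range' (2 * n + 1) (n - τ.length - τ'.length) with hρ
  have hmem : ∀ i ∈ τ, 1 ≤ i ∧ i ≤ n := fun i hi => by
    have := hs.subset hi; simp at this; omega
  have hmem' : ∀ i ∈ τ', n + 1 ≤ i ∧ i ≤ 2 * n := fun i hi => by
    have := hs'.subset hi; simp at this; omega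
  have hmemρ : ∀ i ∈ ρ, 2 * n + 1 ≤ i ∧ i ≤ 3 * n := fun i hi => by
    simp [hρ] at hi; omega
  obtain ⟨g, hg⟩ := exists_contains (N := N) (n := n) (l := τ ++ τ' ++ ρ) (by simp [hρ]; omega)
    (by
      rw [List.nodup_append, List.nodup_append]
      refine ⟨⟨nodup hs List.nodup_range', nodup hs' List.nodup_range', fun i hi j hj => ?_⟩,
        List.nodup_range', fun i hi j hj => ?_⟩
      · have := hmem i hi; have := hmem' j hj; omega
      · have := hmemρ j hj
        rcases List.mem_append.1 hi with hi | hi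
        · have := hmem i hi; omega
        · have := hmem' i hi; omega)
    (by
      intro i hi
      rcases List.mem_append.1 hi with hi | hi
      · rcases List.mem_append.1 hi with hi | hi
        · have := hmem i hi; omega
        · have := hmem' i hi; omega
      · have := hmemρ i hi; omega)
  obtain ⟨⟨hg1, hg2⟩, -⟩ := (contains_append.trans (and_congr_left' contains_append)).1 hg
  have := (hex g).unique (hlead g _ hg1) (hlead' g _ hg2)
  rw [zero_add, zero_add, ← Nat.cast_add, ZMod.natCast_eq_natCast_iff'] at this
  rw [Nat.mod_eq_of_lt (by omega), Nat.mod_eq_of_lt (by omega)] at this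
  omega

end CycleProcess

end Sleeping.Cycle


namespace Sleeping

/-! ### Locality of executions -/

theorem InputGraph.nbrIds_congr {G G' : InputGraph} {v : G.V} {v' : G'.V}
    (h : ∀ i, (∃ u, G.graph.Adj v u ∧ u.1 = i) ↔ ∃ u, G'.graph.Adj v' u ∧ u.1 = i) :
    G.nbrIds v = G'.nbrIds v' := by
  have hsorted : ∀ (G : InputGraph) (v : G.V), (G.nbrIds v).Pairwise (· < ·) := fun G v =>
    List.pairwise_map.2 ((Finset.sortedLT_sort _).pairwise)
  refine List.Pairwise.eq_of_mem_iff (hsorted G v) (hsorted G' v') fun i => ?_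
  rw [Gather.mem_nbrIds, Gather.mem_nbrIds, h]

namespace Algorithm

variable {A : Algorithm} {G G' : InputGraph} {N : ℕ} {v : G.V} {v' : G'.V}

theorem received_congr {c : G.V → VertexStatus} {c' : G'.V → VertexStatus} (hid : v.1 = v'.1)
    (h : ∀ i s, (∃ u, G.graph.Adj v u ∧ u.1 = i ∧ c u = s) ↔
      ∃ u, G'.graph.Adj v' u ∧ u.1 = i ∧ c' u = s) :
    A.received G c v = A.received G' c' v' := by
  have hsorted : ∀ (G : InputGraph) (c : G.V → VertexStatus) (v : G.V),
      (A.received G c v).Pairwise (fun a b => a.1 < b.1) := fun G c v =>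
    List.pairwise_map.2 ((Finset.sortedLT_sort _).pairwise)
  have hmem : ∀ (G : InputGraph) (c : G.V → VertexStatus) (v : G.V) (a : ℕ × ℕ),
      a ∈ A.received G c v ↔ ∃ s, (∃ u, G.graph.Adj v u ∧ u.1 = a.1 ∧ c u = s) ∧ A.Awake s ∧
        A.send s.state v.1 = a.2 := by
    intro G c v a
    simp only [received, List.mem_map, Gather.mem_list]
    constructor
    · rintro ⟨u, ⟨h1, h2⟩, rfl⟩
      exact ⟨_, ⟨u, h1, rfl, rfl⟩, h2, rfl⟩
    · rintro ⟨s, ⟨u, h1, h2, rfl⟩, h3, h4⟩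
      exact ⟨u, ⟨h1, h3⟩, Prod.ext h2 h4⟩
  have : Std.Asymm (fun a b : ℕ × ℕ => a.1 < b.1) := ⟨fun a b h => lt_asymm h⟩
  refine List.Pairwise.eq_of_mem_iff (hsorted G c v) (hsorted G' c' v') fun a => ?_
  simp only [hmem, h, hid]

theorem run_zero_congr (hsize : G.size = G'.size) (hid : v.1 = v'.1)
    (hin : G.input v = G'.input v')
    (h : ∀ i, (∃ u, G.graph.Adj v u ∧ u.1 = i) ↔ ∃ u, G'.graph.Adj v' u ∧ u.1 = i) :
    A.run G N 0 v = A.run G' N 0 v' := by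
  simp only [run]
  rw [hsize, hid, hin, InputGraph.nbrIds_congr h]

theorem run_succ_congr_of_not_awake {t : ℕ} (hst : A.run G N t v = A.run G' N t v')
    (hs : ¬ A.Awake (A.run G N t v)) : A.run G N (t + 1) v = A.run G' N (t + 1) v' := by
  rw [run_succ_of_not_awake hs, run_succ_of_not_awake (hst ▸ hs), hst]

theorem run_succ_congr {t : ℕ} (hid : v.1 = v'.1) (hst : A.run G N t v = A.run G' N t v')
    (h : ∀ i s, (∃ u, G.graph.Adj v u ∧ u.1 = i ∧ A.run G N t u = s) ↔
      ∃ u, G'.graph.Adj v' u ∧ u.1 = i ∧ A.run G' N t u = s) :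
    A.run G N (t + 1) v = A.run G' N (t + 1) v' := by
  by_cases hs : A.Awake (A.run G N t v)
  · rw [run_succ_of_awake hs, run_succ_of_awake (hst ▸ hs), hst, received_congr hid h]
  · exact run_succ_congr_of_not_awake hst hs

theorem run_of_output {T t o : ℕ} (h : A.output (A.run G N T v).state = some o) (ht : T ≤ t) :
    A.output (A.run G N t v).state = some o := by
  induction t, ht using Nat.le_induction with
  | base => exact h
  | succ t _ ih => rwa [run_succ_of_not_awake fun hs => by rw [hs.1] at ih; cases ih]

/-- In a terminating execution, no set of awake rounds of a vertex exceeds the awake complexity. -/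
theorem card_le_awakeComplexity {o : G.V → ℕ} (h : A.Outputs G N o) (v : G.V) (s : Finset ℕ)
    (hs : ∀ t ∈ s, A.Awake (A.run G N t v)) : s.card ≤ A.awakeComplexity G N := by
  obtain ⟨T, hT⟩ := h
  refine le_trans ?_ (Finset.le_sup (f := A.awakeRounds G N) (Finset.mem_univ v))
  rw [← Set.ncard_coe_finset]
  refine Set.ncard_le_ncard hs ((Set.finite_lt_nat T).subset fun t ht => ?_)
  by_contra hcon
  have := run_of_output (hT v) (not_lt.1 hcon)
  rw [ht.1] at this
  cases this

end Algorithm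

end Sleeping

namespace Sleeping.Cycle

variable {n N : ℕ} [NeZero n]

/-! ### Cycles as input graphs -/

/-- The vertex at position `x` of the cycle with labels `f`. -/
def vertex (f : Labelling n N) (x : ZMod n) : {i // i ∈ Finset.univ.image f.1} :=
  ⟨f.1 x, Finset.mem_image_of_mem _ (Finset.mem_univ x)⟩

theorem vertex_injective (f : Labelling n N) : Function.Injective (vertex f) :=
  fun _ _ h => f.2.1 (congrArg Subtype.val h)

theorem vertex_surjective (f : Labelling n N) : Function.Surjective (vertex f) := by
  rintro ⟨i, hi⟩
  obtain ⟨x, -, rfl⟩ := Finset.mem_image.1 hi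
  exact ⟨x, rfl⟩

/-- The cycle with labels `f`, without inputs. -/
def cycle (f : Labelling n N) : InputGraph where
  ids := Finset.univ.image f.1
  ids_pos := by
    intro i hi
    obtain ⟨x, -, rfl⟩ := Finset.mem_image.1 hi
    exact (f.2.2 x).1
  graph := SimpleGraph.fromRel fun u v => ∃ x, u = vertex f x ∧ v = vertex f (x + 1)
  connected := by
    rw [SimpleGraph.connected_iff_exists_forall_reachable]
    refine ⟨vertex f 0, fun v => ?_⟩
    obtain ⟨x, rfl⟩ := vertex_surjective f v
    rw [← ZMod.natCast_zmod_val x]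
    induction x.val with
    | zero => rw [Nat.cast_zero]
    | succ i ih =>
      refine ih.trans ?_
      by_cases h : vertex f (i : ZMod n) = vertex f ((i + 1 : ℕ) : ZMod n)
      · rw [h]
      · refine SimpleGraph.Adj.reachable ?_
        rw [SimpleGraph.fromRel_adj]
        exact ⟨h, Or.inl ⟨_, rfl, by rw [Nat.cast_succ]⟩⟩
  input := fun _ => 0

theorem size_cycle (f : Labelling n N) : (cycle f).size = n := by
  show (Finset.univ.image f.1).card = n
  rw [Finset.card_image_of_injective _ f.2.1, Finset.card_univ, ZMod.card]

theorem boundedBy_cycle (f : Labelling n N) : (cycle f).BoundedBy N := by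
  intro i hi
  obtain ⟨x, -, rfl⟩ := Finset.mem_image.1 hi
  exact (f.2.2 x).2

theorem adj_cycle (hn : 2 ≤ n) {f : Labelling n N} {x : ZMod n} {u : (cycle f).V} :
    (cycle f).graph.Adj (vertex f x) u ↔ u = vertex f (x - 1) ∨ u = vertex f (x + 1) := by
  have : Fact (1 < n) := ⟨hn⟩
  refine (SimpleGraph.fromRel_adj _ _ _).trans ?_
  constructor
  · rintro ⟨-, ⟨y, h1, rfl⟩ | ⟨y, rfl, h1⟩⟩
    · rw [vertex_injective f h1]; exact Or.inr rfl
    · rw [vertex_injective f h1, add_sub_cancel_right]; exact Or.inl rfl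
  · rintro (rfl | rfl)
    · refine ⟨fun h => ?_, Or.inr ⟨x - 1, rfl, by rw [sub_add_cancel]⟩⟩
      exact one_ne_zero (sub_eq_self.1 (vertex_injective f h).symm)
    · refine ⟨fun h => ?_, Or.inl ⟨x, rfl, rfl⟩⟩
      exact one_ne_zero (left_eq_add.1 (vertex_injective f h))

section Locality

variable {A : Algorithm} {f g : Labelling n N} {x y : ZMod n} {t : ℕ}
  {a : (cycle f).V → ℕ} {b : (cycle g).V → ℕ}

/-- The statuses of an execution on the cycle with labels `f` and inputs `a`, by position. -/
noncomputable def statusAt (A : Algorithm) (f : Labelling n N) (a : (cycle f).V → ℕ) (t : ℕ)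
    (x : ZMod n) : VertexStatus :=
  A.run ((cycle f).withInput a) N t (vertex f x)

theorem exists_adj_iff (hn : 2 ≤ n) {p : (cycle f).V → Prop} :
    (∃ u, ((cycle f).withInput a).graph.Adj (vertex f x) u ∧ p u) ↔
      p (vertex f (x - 1)) ∨ p (vertex f (x + 1)) := by
  constructor
  · rintro ⟨u, h, hp⟩
    rcases (adj_cycle hn).1 h with rfl | rfl
    exacts [Or.inl hp, Or.inr hp]
  · rintro (hp | hp)
    exacts [⟨_, (adj_cycle hn).2 (Or.inl rfl), hp⟩, ⟨_, (adj_cycle hn).2 (Or.inr rfl), hp⟩]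

theorem statusAt_zero (hn : 2 ≤ n) (h : SameView f g x y)
    (hin : a (vertex f x) = b (vertex g y)) : statusAt A f a 0 x = statusAt A g b 0 y := by
  refine Algorithm.run_zero_congr ((size_cycle f).trans (size_cycle g).symm) h.self hin fun i => ?_
  refine (exists_adj_iff hn (p := fun u => u.1 = i)).trans
    (Iff.trans ?_ (exists_adj_iff hn (p := fun u => u.1 = i)).symm)
  exact or_congr (Eq.congr_left h.prev) (Eq.congr_left h.next)

theorem statusAt_succ (hn : 2 ≤ n) (h : SameView f g x y)
    (h0 : statusAt A f a t x = statusAt A g b t y)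
    (h1 : statusAt A f a t (x - 1) = statusAt A g b t (y - 1))
    (h2 : statusAt A f a t (x + 1) = statusAt A g b t (y + 1)) :
    statusAt A f a (t + 1) x = statusAt A g b (t + 1) y := by
  refine Algorithm.run_succ_congr h.self h0 fun i s => ?_
  refine (exists_adj_iff hn (p := fun u => u.1 = i ∧ A.run ((cycle f).withInput a) N t u = s)).trans
    (Iff.trans ?_
      (exists_adj_iff hn (p := fun u => u.1 = i ∧ A.run ((cycle g).withInput b) N t u = s)).symm)
  exact or_congr (and_congr (Eq.congr_left h.prev) (Eq.congr_left h1))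
    (and_congr (Eq.congr_left h.next) (Eq.congr_left h2))

end Locality

end Sleeping.Cycle


namespace Sleeping.Cycle

/-! ### The lower bound -/

section Composition

variable {n N : ℕ} [NeZero n] {A R : Algorithm} {s : ∀ f : Labelling n N, (cycle f).V → ℕ}

/-- The inputs with which a second algorithm starts when the outputs of the first one are `s`. -/
def pairedInput (s : ∀ f : Labelling n N, (cycle f).V → ℕ) (f : Labelling n N) (v : (cycle f).V) :
    ℕ :=
  Nat.pair ((cycle f).input v) (s f v)

/-- The process in which `A` runs until time `T`, when it has terminated on all cycles, and `R` runs
from time `T + 1` on with the outputs of `A` as part of the inputs. -/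
noncomputable def composition (hn : 2 ≤ n) (A R : Algorithm)
    (s : ∀ f : Labelling n N, (cycle f).V → ℕ) (T : ℕ)
    (hT : ∀ f v, A.output (A.run (cycle f) N T v).state = some (s f v)) : CycleProcess n N where
  status f t x :=
    if t ≤ T then statusAt A f (cycle f).input t x
    else statusAt R f (pairedInput s f) (t - (T + 1)) x
  Awake t c := if t ≤ T then A.Awake c else R.Awake c
  status_zero {f g x y} h := by
    simp only [Nat.zero_le, if_true]
    exact statusAt_zero hn h rfl
  status_succ {f g x y t} h h0 h1 h2 := by
    rcases lt_trichotomy t T with ht | rfl | ht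
    · simp only [ht.le, Nat.succ_le_of_lt ht, if_true] at *
      exact statusAt_succ hn h h0 h1 h2
    · simp only [le_refl, if_true, not_le.2 (Nat.lt_succ_self t), if_false, Nat.sub_self] at *
      refine statusAt_zero hn h (congrArg (Nat.pair 0) (Option.some.inj ?_))
      exact (hT f _).symm.trans ((congrArg (fun c => A.output c.state) h0).trans (hT g _))
    · have e : t + 1 - (T + 1) = t - (T + 1) + 1 := by omega
      simp only [not_le.2 ht, show ¬ t + 1 ≤ T by omega, if_false, e] at *
      exact statusAt_succ hn h h0 h1 h2
  status_succ_of_not_awake {f g x y t} h h0 hs := by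
    rcases lt_trichotomy t T with ht | rfl | ht
    · simp only [ht.le, Nat.succ_le_of_lt ht, if_true] at *
      exact Algorithm.run_succ_congr_of_not_awake h0 hs
    · simp only [le_refl, if_true, not_le.2 (Nat.lt_succ_self t), if_false, Nat.sub_self] at *
      refine statusAt_zero hn h (congrArg (Nat.pair 0) (Option.some.inj ?_))
      exact (hT f _).symm.trans ((congrArg (fun c => A.output c.state) h0).trans (hT g _))
    · have e : t + 1 - (T + 1) = t - (T + 1) + 1 := by omega
      simp only [not_le.2 ht, show ¬ t + 1 ≤ T by omega, if_false, e] at *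
      exact Algorithm.run_succ_congr_of_not_awake h0 hs

instance : Finite (Labelling n N) := by
  refine Finite.of_injective (β := ZMod n → Fin (N + 1))
    (fun f x => ⟨f.1 x, Nat.lt_succ_of_le (f.2.2 x).2⟩) fun f g h => ?_
  refine Subtype.ext (funext fun x => ?_)
  exact congrArg Fin.val (congrFun h x)

/-- If vertices are awake rarely, then two algorithms cannot single out one vertex of every
cycle. -/
theorem not_existsUnique_output {k : ℕ} {E : ℕ → Prop} {o : ∀ f : Labelling n N, (cycle f).V → ℕ}
    (hs : ∀ f, A.Outputs (cycle f) N (s f))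
    (ho : ∀ f, R.Outputs ((cycle f).withInput (pairedInput s f)) N (o f))
    (hE : ∀ f, ∃! v, E (o f v))
    (hk : ∀ f, A.awakeComplexity (cycle f) N +
      R.awakeComplexity ((cycle f).withInput (pairedInput s f)) N ≤ k)
    (hn : 6 * 3 ^ (k + 2) + 12 ≤ n) (hN : 3 * n ≤ N) : False := by
  choose τ hτ using hs
  obtain ⟨T, hT⟩ := Finite.bddAbove_range τ
  have hT' : ∀ f v, A.output (A.run (cycle f) N T v).state = some (s f v) := fun f v =>
    Algorithm.run_of_output (hτ f v) (hT ⟨f, rfl⟩)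
  have hn2 : 2 ≤ n := by omega
  refine CycleProcess.not_existsUnique_leader (Y := composition hn2 A R s T hT') (k := k)
    (Lead := fun f x => E (o f (vertex f x))) ?_ ?_ ?_ hn hN
  · intro f x S hS
    classical
    rw [← Finset.card_filter_add_card_filter_not (s := S) (· ≤ T)]
    refine le_trans (Nat.add_le_add ?_ ?_) (hk f)
    · refine Algorithm.card_le_awakeComplexity ⟨τ f, hτ f⟩ (vertex f x) _ fun t ht => ?_
      obtain ⟨ht, hle⟩ := Finset.mem_filter.1 ht
      have := hS t ht
      simp only [composition, hle, if_true] at this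
      exact this
    · rw [← Finset.card_image_of_injOn (f := fun t => t - (T + 1))]
      · refine Algorithm.card_le_awakeComplexity (ho f) (vertex f x) _ fun t ht => ?_
        obtain ⟨t, hmem, rfl⟩ := Finset.mem_image.1 ht
        obtain ⟨ht, hle⟩ := Finset.mem_filter.1 hmem
        have := hS t ht
        simp only [composition, hle, if_false] at this
        exact this
      · intro t ht t' ht' h
        have h1 := (Finset.mem_filter.1 ht).2
        have h2 := (Finset.mem_filter.1 ht').2
        simp only at h
        omega
  · intro f
    obtain ⟨v, hv, huniq⟩ := hE f
    obtain ⟨x, rfl⟩ := vertex_surjective f v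
    exact ⟨x, hv, fun y hy => vertex_injective f (huniq _ hy)⟩
  · intro f g x y h hx
    obtain ⟨T₁, h₁⟩ := ho f
    obtain ⟨T₂, h₂⟩ := ho g
    have h₁ := Algorithm.run_of_output (h₁ (vertex f x)) (le_max_left T₁ T₂)
    have h₂ := Algorithm.run_of_output (h₂ (vertex g y)) (le_max_right T₁ T₂)
    have := h (T + 1 + max T₁ T₂)
    simp only [composition, show ¬ T + 1 + max T₁ T₂ ≤ T by omega, if_false,
      Nat.add_sub_cancel_left] at this
    have := h₁.symm.trans ((congrArg (fun c => R.output c.state) this).trans h₂)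
    show E _
    rwa [← Option.some.inj this]

end Composition

/-- A solution of a DLT-hard problem yields a single leader, recognised by its output: the root is
the only vertex of a distributed layered tree whose output names no parent. -/
theorem exists_leader_of_dltHard {P : Problem} (hP : DLTHard P) :
    ∃ (R : Algorithm) (r : ℕ → ℝ) (E : ℕ → Prop), r =o[atTop] (fun n : ℕ => Real.log n) ∧
      ∀ (G : InputGraph) (N : ℕ) (s : G.V → ℕ), G.BoundedBy N → P.IsSolution G s →
        (∃ o : G.V → ℕ, R.Outputs (G.withInput fun v => Nat.pair (G.input v) (s v)) N o ∧
          ∃! v, E (o v)) ∧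
        (R.awakeComplexity (G.withInput fun v => Nat.pair (G.input v) (s v)) N : ℝ) ≤ r G.size := by
  rcases hP with ⟨R, r, hr, h⟩ | ⟨R, r, hr, h⟩
  · refine ⟨R, r, fun o => ∃ L : ℕ, o = Encodable.encode (L, (none : Option (ℕ × ℕ))), hr,
      fun G N s hG hs => ⟨?_, (h G N s hG hs).2⟩⟩
    obtain ⟨o, ho, root, parent, L, -, -, hroot, hother⟩ := (h G N s hG hs).1
    refine ⟨o, ho, root, ⟨_, hroot⟩, fun v hv => ?_⟩
    by_contra hne
    obtain ⟨L', hL'⟩ := hv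
    have := Encodable.encode_injective ((hother v hne).symm.trans hL')
    simp at this
  · exact ⟨R, r, (· = 1), hr, h⟩

/-- The segments of `3 ^ (k + 2)` labels are short compared with `n`: as `3 ≤ exp 2`,
their length is at most `9 * √n`. -/
theorem pow_le_of_le_log {k n : ℕ} (hn : 10000 ≤ n) (hk : (k : ℝ) ≤ Real.log n / 4) :
    6 * 3 ^ (k + 2) + 12 ≤ n := by
  have hn0 : (0 : ℝ) < n := by exact_mod_cast (by omega : 0 < n)
  have h3 : (3 : ℝ) ≤ Real.exp 2 := by
    have := Real.add_one_le_exp (2 : ℝ); linarith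
  have h1 : (3 : ℝ) ^ k ≤ Real.sqrt n := by
    calc (3 : ℝ) ^ k ≤ Real.exp 2 ^ k := by gcongr
      _ = Real.exp (k * 2) := (Real.exp_nat_mul 2 k).symm
      _ ≤ Real.exp (Real.log n / 2) := Real.exp_le_exp.2 (by linarith)
      _ = Real.sqrt n := by rw [← Real.log_sqrt hn0.le, Real.exp_log (Real.sqrt_pos.2 hn0)]
  have h2 : Real.sqrt n * Real.sqrt n = n := Real.mul_self_sqrt hn0.le
  have h4 : (100 : ℝ) ≤ Real.sqrt n := by
    refine Real.le_sqrt_of_sq_le ?_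
    norm_num
    exact_mod_cast hn
  have : (6 * 3 ^ (k + 2) + 12 : ℝ) ≤ n := by
    rw [pow_add]; nlinarith
  exact_mod_cast this

/-- Otherwise `A` followed by the algorithm that elects a leader would have at most `log n / 4`
awake rounds per vertex on all labelled cycles. -/
theorem exists_awakeComplexity_ge {P : Problem} (hP : DLTHard P) :
    ∃ (n₀ : ℕ) (ρ : ℕ → ℕ), ∀ n, n₀ ≤ n → ∀ N, ρ n ≤ N → ∀ A : Algorithm, A.SolvesAt P n N →
      ∃ G : InputGraph, G.size = n ∧ G.BoundedBy N ∧
        1 / 8 * Real.log n ≤ (A.awakeComplexity G N : ℝ) := by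
  obtain ⟨R, r, E, hr, hR⟩ := exists_leader_of_dltHard hP
  obtain ⟨n₁, hn₁⟩ := eventually_atTop.1 (hr.def (show (0 : ℝ) < 1 / 8 by norm_num))
  refine ⟨max n₁ 10000, fun n => 3 * n, fun n hn N hN A hA => ?_⟩
  by_contra! hlow
  have hn' : 10000 ≤ n := (le_max_right _ _).trans hn
  have : NeZero n := ⟨by omega⟩
  have hlog : 0 ≤ Real.log n := Real.log_natCast_nonneg n
  have hrn : r n ≤ 1 / 8 * Real.log n := by
    have := hn₁ n ((le_max_left _ _).trans hn)
    rw [Real.norm_eq_abs, Real.norm_eq_abs, abs_of_nonneg hlog] at this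
    exact (le_abs_self _).trans this
  choose s hs using fun f : Labelling n N => hA (cycle f) (size_cycle f) (boundedBy_cycle f)
  have hR' := fun f : Labelling n N => hR (cycle f) N (s f) (boundedBy_cycle f) (hs f).2
  choose o ho using fun f => (hR' f).1
  refine not_existsUnique_output (k := ⌊Real.log n / 4⌋₊) (fun f => (hs f).1)
    (fun f => (ho f).1) (fun f => (ho f).2) (fun f => Nat.le_floor ?_)
    (pow_le_of_le_log hn' (Nat.floor_le (by positivity))) hN
  have h1 := hlow (cycle f) (size_cycle f) (boundedBy_cycle f)
  have h2 := (hR' f).2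
  rw [size_cycle] at h2
  push_cast
  change _ + (R.awakeComplexity ((cycle f).withInput (pairedInput s f)) N : ℝ) ≤ _
  change (R.awakeComplexity ((cycle f).withInput (pairedInput s f)) N : ℝ) ≤ _ at h2
  linarith

end Sleeping.Cycle


theorem mainTheorem4 :
    ∃ c C : ℝ, 0 < c ∧ 0 < C ∧
      ∀ P : Sleeping.Problem, P.IsDecidable → Sleeping.DLTHard P →
        (∃ A : Sleeping.Algorithm, A.IsComputable ∧ A.UsesOnlyBound ∧ A.Solves P ∧
          ∀ (G : Sleeping.InputGraph) (N : ℕ), G.BoundedBy N → 2 ≤ G.size →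
            (A.awakeComplexity G N : ℝ) ≤ C * Real.log G.size) ∧
        (∃ (n₀ : ℕ) (ρ : ℕ → ℕ), ∀ n, n₀ ≤ n → ∀ N, ρ n ≤ N →
          ∀ A : Sleeping.Algorithm, A.SolvesAt P n N →
            ∃ G : Sleeping.InputGraph, G.size = n ∧ G.BoundedBy N ∧
              c * Real.log n ≤ (A.awakeComplexity G N : ℝ)) :=
  ⟨1 / 8, 60, by norm_num, by norm_num, fun _ hdec hhard =>
    ⟨Sleeping.Gather.exists_algorithm hdec, Sleeping.Cycle.exists_awakeComplexity_ge hhard⟩⟩
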